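/- **Setting.** Let $\Omega=\mathbb R^d$ or $\Omega=\mathbb T^d=(\mathbb R/\mathbb Z)^d$, let $\sigma>d/2$, and let $H^\sigma=H^\sigma(\Omega,\mathbb C)$ be the Sobolev space with norm $\|f\|_{H^\sigma}=\big(\int|\hat f(\xi)|^2(1+|\xi|^2)^\sigma\,d\xi\big)^{1/2}$ (respectively $\big(\sum_{k\in\mathbb Z^d}|\hat f(k)|^2(1+|k|^2)^\sigma\big)^{1/2}$), which is an algebra under pointwise multiplication. Let $L=i\Delta$ or $L=\Delta$, and consider $$\partial_t u = Lu+N(u)u,\qquad u(0)=u^0\in H^\sigma ,$$ where $N:H^\sigma\to H^\sigma$ maps bounded sets to bounded sets and is Lipschitz continuous on bounded sets. Let $s\ge 1$, $T_\star<0<T<T^\star$, and assume that $u$ is a solution on $(T_\star,T^\star)$ which is $C^{s+2}$ in time with values in $H^\sigma$, and that $t\mapsto N(u(t))$ is $C^s$ on $(T_\star,T^\star)$ with values in $H^\sigma$. Let $r>0$, $V=\{u(t)+v:\ t\in[0,T],\ \|v\|_{H^\sigma}\le r\}$, and let $M,m>0$ be such that $\|N(u(t))\|_{H^\sigma}\le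 M$ for all $t\in[0,T]$ and $\|N(v)\|_{H^\sigma}<M+m$ for all $v\in V$. **Method.** Let $0\le c_1<\dots<c_s\le 1$ and let $A=(a_{ij})$, $b=(b_i)$ be the coefficients of the collocation Runge–Kutta method at these points: $a_{ij}=\int_0^{c_i}\ell_j$, $b_i=\int_0^1\ell_i$, with $\ell_1,\dots,\ell_s$ the Lagrange polynomials of $c_1,\dots,c_s$. Let $D\in\mathcal M_s(\mathbb C)$ and $\Theta\in\mathbb C^s$ be such that $D$ has spectral radius $<1$ (strong stability) and $V_c=DV_{c-\mathbb 1}+\vartheta$ (consistency of order $s$), where $(V_c)_{ij}=c_i^{j-1}$, $(V_{c-\mathbb 1})_{ij}=(c_i-1)^{j-1}$, and $\vartheta$ is the $s\times s$ matrix with first column $\Theta$ and zero elsewhere. Given a step $h>0$, $t_n=nh$, $u_0\in H^\sigma$ and $\Gamma_{-1}=(\gamma_{-1,i})_i\in(H^\sigma)^s$, the linearly implicit method computes, for $n\ge0$, $\Gamma_n=(\gamma_{n,i})_i$, $(u_{n,i})_i\in(H^\sigma)^s$ and $u_{n+1}\in H^\sigma$ by $$\Gamma_n=D\Gamma_{n-1}+\Theta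 N(u_n),\qquad u_{n,i}=u_n+h\sum_{j=1}^s a_{ij}(L+\gamma_{n,j})u_{n,j}\quad(1\le i\le s),\qquad u_{n+1}=u_n+h\sum_{i=1}^s b_i(L+\gamma_{n,i})u_{n,i}.$$ **Stability.** Let $R(\lambda)=1+\lambda b^t(I-\lambda A)^{-1}\mathbb 1$. For a set $S\subset\mathbb C$ consider the conditions: $|R(\lambda)|\le1$ for all $\lambda\in S$; $I-\lambda A$ is invertible for all $\lambda\in S$; $\lambda b^t(I-\lambda A)^{-1}$ and $(I-\lambda A)^{-1}$ are bounded uniformly in $\lambda\in S$. The method is $\hat A$-stable if they hold with $S=\{\mathrm{Re}\,\lambda\le0\}$, and $\hat I$-stable if they hold with $S=i\mathbb R$. **Theorem.** Assume that $L=i\Delta$ and the Runge–Kutta method is $\hat I$-stable, or that $L=\Delta$ and it is $\hat A$-stable. Then there exist $C>0$, $h_0\in(0,T)$ with $h_0<-T_\star$, a neighbourhood $W$ of $u^0$ in $H^\sigma$, and $\varepsilon>0$ such that for all $u_0\in W$, all $h\in(0,h_0)$ and all $\gamma_{-1,1},\dots,\gamma_{-1,s}\in H^\sigma$ with $\|N(u(t_{-1}+c_ih))-\gamma_{-1,i}\|_{H^\sigma}<\varepsilon$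 for all $i$, the method is well defined for every $n\in\mathbb N$ with $0\le nh\le T$ (the linear system for $(u_{n,i})_i$ has exactly one solution in $(H^\sigma)^s$, and $u_{n+1}\in H^\sigma$). Moreover, for every such $n$, $\|\gamma_{n-1,i}\|_{H^\sigma}\le M+m$ for all $i\in\{1,\dots,s\}$, and $$\max_{0\le k\le n}\|u(t_k)-u_k\|_{H^\sigma}\le e^{Cnh}\Big(\|u^0-u_0\|_{H^\sigma}+C\Big(\max_{1\le i\le s}\|N(u(t_{-1}+c_ih))-\gamma_{-1,i}\|_{H^\sigma}+h^s\Big)\Big).$$ -/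

import Mathlib

open MeasureTheory Set Topology

noncomputable section

/-! ### Spatial domains and their Fourier transform -/

/-- A spatial domain (with its measure `μ`) together with the Fourier description of `L²`: the
frequency space (with its measure `ν`), the Fourier transform on `L²`, the squared length of a
frequency, and the real Fourier symbol of the Laplace operator.
The only two instances used are `wholeSpace d` and `torus d` below. -/
structure FourierDomain where
  Pt : Type
  [measPt : MeasurableSpace Pt]
  μ : Measure Pt
  Freq : Type
  [measFreq : MeasurableSpace Freq]
  ν : Measure Freq
  hat : Lp ℂ 2 μ →ₗ[ℂ] (Freq →ₘ[ν] ℂ)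
  hat_injective : Function.Injective hat
  sqFreq : Freq → ℝ
  sqFreq_nonneg : ∀ ξ, 0 ≤ sqFreq ξ
  sqFreq_measurable : Measurable sqFreq
  lap : Freq → ℝ
  lap_measurable : Measurable lap

attribute [instance] FourierDomain.measPt FourierDomain.measFreq

/-- `Ω = ℝᵈ`. The Fourier transform is the Plancherel transform
`𝓕 f (η) = ∫ f(x) exp(-2πi x·η) dx`. The frequency in the convention `exp(-i x·ξ)` is `ξ = 2πη`;
hence `|ξ|² = |2πη|²`, the symbol of `Δ` is `-|2πη|²`, and
`∫ |𝓕 f(η)|² (1+|2πη|²)^σ dη = ∫ |f^(ξ)|² (1+|ξ|²)^σ dξ` for the unitary transform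
`f^(ξ) = (2π)^(-d/2) ∫ f(x) exp(-i x·ξ) dx`. -/
def wholeSpace (d : ℕ) : FourierDomain where
  Pt := EuclideanSpace ℝ (Fin d)
  μ := volume
  Freq := EuclideanSpace ℝ (Fin d)
  ν := volume
  hat := (Lp.LpSubmodule ℂ ℂ 2 (volume : Measure (EuclideanSpace ℝ (Fin d)))).subtype ∘ₗ
    (Lp.fourierTransformₗᵢ (EuclideanSpace ℝ (Fin d)) ℂ).toLinearEquiv.toLinearMap
  hat_injective := fun _ _ h =>
    (Lp.fourierTransformₗᵢ (EuclideanSpace ℝ (Fin d)) ℂ).injective (Subtype.ext h)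
  sqFreq := fun η => ‖(2 * Real.pi) • η‖ ^ 2
  sqFreq_nonneg := fun _ => by positivity
  sqFreq_measurable := by fun_prop
  lap := fun η => -‖(2 * Real.pi) • η‖ ^ 2
  lap_measurable := by fun_prop

/-- `Ω = 𝕋ᵈ = (ℝ/ℤ)ᵈ` with its normalized Haar measure. The Fourier transform maps `f` to its
Fourier coefficients `k ↦ ∫ f(x) exp(-2πi k·x) dx`, `k ∈ ℤᵈ`; the frequency space carries the
counting measure; the symbol of `Δ` is `-4π²|k|²`. -/
def torus (d : ℕ) : FourierDomain where
  Pt := UnitAddTorus (Fin d)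
  μ := Measure.pi fun _ => AddCircle.haarAddCircle
  Freq := Fin d → ℤ
  ν := Measure.count
  hat :=
    { toFun := fun f => AEEqFun.mk (fun k => UnitAddTorus.mFourierCoeff f k)
        (measurable_of_countable _).aestronglyMeasurable
      map_add' := fun f g => by
        rw [AEEqFun.mk_add_mk, AEEqFun.mk_eq_mk]
        refine Filter.Eventually.of_forall fun k => ?_
        simp only [Pi.add_apply]
        erw [← UnitAddTorus.mFourierBasis_repr, ← UnitAddTorus.mFourierBasis_repr,
          ← UnitAddTorus.mFourierBasis_repr]
        exact congrArg (fun F : lp (fun _ : Fin d → ℤ => ℂ) 2 => (F : (Fin d → ℤ) → ℂ) k)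
          (map_add UnitAddTorus.mFourierBasis.repr f g)
      map_smul' := fun c f => by
        rw [RingHom.id_apply]
        refine AEEqFun.mk_eq_mk.mpr (Filter.Eventually.of_forall fun k => ?_)
        refine (UnitAddTorus.mFourierBasis_repr (c • f) k).symm.trans ?_
        refine Eq.trans ?_ (congrArg (c • ·) (UnitAddTorus.mFourierBasis_repr f k))
        exact congrArg (fun F : lp (fun _ : Fin d → ℤ => ℂ) 2 => (F : (Fin d → ℤ) → ℂ) k)
          (map_smul UnitAddTorus.mFourierBasis.repr c f) }
  hat_injective := fun f g h => by
    have h' := AEEqFun.mk_eq_mk.mp h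
    rw [Filter.EventuallyEq, Measure.ae_count_iff] at h'
    refine UnitAddTorus.mFourierBasis.repr.injective (lp.ext (funext fun k => ?_))
    erw [UnitAddTorus.mFourierBasis_repr, UnitAddTorus.mFourierBasis_repr]
    exact h' k
  sqFreq := fun k => ∑ j, (k j : ℝ) ^ 2
  sqFreq_nonneg := fun _ => by positivity
  sqFreq_measurable := measurable_of_countable _
  lap := fun k => -(4 * Real.pi ^ 2 * ∑ j, (k j : ℝ) ^ 2)
  lap_measurable := measurable_of_countable _

/-! ### Sobolev spaces -/

namespace FourierDomain

variable (Ω : FourierDomain) (σ : ℝ)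

/-- Multiplication by a measurable function of the frequency. -/
def multiplier (m : Ω.Freq → ℂ) (hm : Measurable m) :
    (Ω.Freq →ₘ[Ω.ν] ℂ) →ₗ[ℂ] (Ω.Freq →ₘ[Ω.ν] ℂ) where
  toFun F := AEEqFun.mk m hm.aestronglyMeasurable * F
  map_add' F G := by
    induction F, G using AEEqFun.induction_on₂ with
    | _ f hf g hg =>
      simp only [AEEqFun.mk_add_mk, AEEqFun.mk_mul_mk, AEEqFun.mk_eq_mk]
      exact Filter.Eventually.of_forall fun x => mul_add _ _ _
  map_smul' c F := by
    induction F using AEEqFun.induction_on with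
    | _ f hf =>
      rw [RingHom.id_apply, AEEqFun.mk_mul_mk]
      refine AEEqFun.mk_eq_mk.mpr ?_
      exact Filter.Eventually.of_forall fun x => mul_smul_comm c (m x) (f x)

/-- `f ↦ (1+|ξ|²)^(σ/2) f^(ξ)`. -/
def weightedHat : Lp ℂ 2 Ω.μ →ₗ[ℂ] (Ω.Freq →ₘ[Ω.ν] ℂ) :=
  Ω.multiplier (fun ξ => (((1 + Ω.sqFreq ξ) ^ (σ / 2) : ℝ) : ℂ))
    (Complex.measurable_ofReal.comp ((Ω.sqFreq_measurable.const_add 1).pow_const _)) ∘ₗ Ω.hat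

/-- The subspace of all `f ∈ L²` such that `(1+|ξ|²)^(σ/2) f^(ξ)` is square integrable. -/
def sobolevSubmodule : Submodule ℂ (Lp ℂ 2 Ω.μ) :=
  (Lp.LpSubmodule ℂ ℂ 2 Ω.ν).comap (Ω.weightedHat σ)

/-- The Sobolev space `H^σ(Ω)` (for `σ ≥ 0`). -/
def Sobolev : Type := Ω.sobolevSubmodule σ

namespace Sobolev

variable {Ω σ}

instance : AddCommGroup (Ω.Sobolev σ) := inferInstanceAs (AddCommGroup (Ω.sobolevSubmodule σ))

instance : Module ℂ (Ω.Sobolev σ) := inferInstanceAs (Module ℂ (Ω.sobolevSubmodule σ))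

/-- The underlying function class in `L²(Ω)`. -/
def toL2 : Ω.Sobolev σ →ₗ[ℂ] Lp ℂ 2 Ω.μ := (Ω.sobolevSubmodule σ).subtype

/-- The Fourier transform of an element of `H^σ`. -/
def hat : Ω.Sobolev σ →ₗ[ℂ] (Ω.Freq →ₘ[Ω.ν] ℂ) := Ω.hat ∘ₗ toL2

/-- `f ↦ (1+|ξ|²)^(σ/2) f^(ξ)` as a map from `H^σ` to `L²` in frequency. -/
def toWeightedL2 : Ω.Sobolev σ →ₗ[ℂ] Lp ℂ 2 Ω.ν where
  toFun f := ⟨Ω.weightedHat σ (toL2 f), f.2⟩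
  map_add' f g := Subtype.ext (by simp)
  map_smul' c f := Subtype.ext (by simp only [map_smul]; rfl)

theorem toWeightedL2_coeFn (f : Ω.Sobolev σ) :
    toWeightedL2 f =ᵐ[Ω.ν]
      fun ξ => (((1 + Ω.sqFreq ξ) ^ (σ / 2) : ℝ) : ℂ) * hat f ξ := by
  refine (AEEqFun.coeFn_mul _ _).trans ?_
  filter_upwards [AEEqFun.coeFn_mk (μ := Ω.ν)
    (fun ξ => (((1 + Ω.sqFreq ξ) ^ (σ / 2) : ℝ) : ℂ))
    (Complex.measurable_ofReal.comp
      ((Ω.sqFreq_measurable.const_add 1).pow_const _)).aestronglyMeasurable] with ξ hξ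
  simp only [Pi.mul_apply, hξ]
  rfl

theorem toWeightedL2_injective : Function.Injective (toWeightedL2 (Ω := Ω) (σ := σ)) := by
  intro f g hfg
  have hfg' : hat f = hat g := by
    apply AEEqFun.ext
    have hf := toWeightedL2_coeFn f
    rw [hfg] at hf
    filter_upwards [hf, toWeightedL2_coeFn g] with ξ h1 h2
    have hpos : ((1 + Ω.sqFreq ξ) ^ (σ / 2) : ℝ) ≠ 0 :=
      (Real.rpow_pos_of_pos (by linarith [Ω.sqFreq_nonneg ξ]) _).ne'
    exact mul_left_cancel₀ (Complex.ofReal_ne_zero.mpr hpos) (h1.symm.trans h2)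
  exact Subtype.ext (Ω.hat_injective hfg')

/-- The norm of `H^σ`: `‖f‖ = (∫ |f^(ξ)|² (1+|ξ|²)^σ dν(ξ))^(1/2)`, see `norm_sq_eq`. -/
instance : NormedAddCommGroup (Ω.Sobolev σ) :=
  NormedAddCommGroup.induced _ (Lp ℂ 2 Ω.ν) toWeightedL2 toWeightedL2_injective

instance : NormedSpace ℂ (Ω.Sobolev σ) :=
  NormedSpace.induced ℂ (Ω.Sobolev σ) (Lp ℂ 2 Ω.ν) toWeightedL2

theorem norm_sq_eq (f : Ω.Sobolev σ) :
    ‖f‖ ^ 2 = ∫ ξ, ‖hat f ξ‖ ^ 2 * (1 + Ω.sqFreq ξ) ^ σ ∂Ω.ν := by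
  have h : ‖f‖ = ‖toWeightedL2 f‖ := rfl
  rw [h, ← @inner_self_eq_norm_sq ℂ, L2.inner_def, ← integral_re (L2.integrable_inner _ _)]
  refine integral_congr_ae ?_
  filter_upwards [toWeightedL2_coeFn f] with ξ hξ
  have h0 : 0 ≤ 1 + Ω.sqFreq ξ := by linarith [Ω.sqFreq_nonneg ξ]
  have h1 : ((1 + Ω.sqFreq ξ) ^ (σ / 2)) ^ 2 = (1 + Ω.sqFreq ξ) ^ σ := by
    rw [← Real.rpow_natCast, ← Real.rpow_mul h0]; congr 1; push_cast; ring
  rw [inner_self_eq_norm_sq, hξ, norm_mul, mul_pow, Complex.norm_real, Real.norm_eq_abs, sq_abs,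
    h1, mul_comm]

/-- `w` is the pointwise product of `f` and `g`. -/
def IsProduct (f g w : Ω.Sobolev σ) : Prop :=
  toL2 w =ᵐ[Ω.μ] fun x => toL2 f x * toL2 g x

end Sobolev

end FourierDomain

open FourierDomain FourierDomain.Sobolev

/-! ### The evolution equation `∂ₜu = Lu + N(u)u` -/

/-- The two linear operators: `L = iΔ` (Schrödinger) and `L = Δ` (heat). -/
inductive LinearPart
  | schrodinger
  | heat

/-- `L = λΔ` with `λ = i` or `λ = 1`. -/
def LinearPart.factor : LinearPart → ℂ
  | .schrodinger => Complex.I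
  | .heat => 1

section Evolution

variable {Ω : FourierDomain} {σ : ℝ}

/-- The Fourier transform of `L f`, for `f ∈ H^σ`. In general `L f` only lies in `H^(σ-2)`. -/
def LinearPart.applyHat (L : LinearPart) (f : Ω.Sobolev σ) : Ω.Freq →ₘ[Ω.ν] ℂ :=
  Ω.multiplier (fun ξ => L.factor * (Ω.lap ξ : ℂ))
    ((Complex.measurable_ofReal.comp Ω.lap_measurable).const_mul _) (hat f)

/-- `u` solves `∂ₜu = Lu + N(u)u` on the time interval `(Tlo, Thi)`. -/
def IsExactSolution (L : LinearPart) (N : Ω.Sobolev σ → Ω.Sobolev σ) (u : ℝ → Ω.Sobolev σ)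
    (Tlo Thi : ℝ) : Prop :=
  ∀ t ∈ Ioo Tlo Thi, ∃ u' g : Ω.Sobolev σ, HasDerivAt u u' t ∧
    IsProduct (N (u t)) (u t) g ∧ hat u' = L.applyHat (u t) + hat g

end Evolution

/-! ### Runge–Kutta methods -/

/-- The real coefficients of an `s`-stage Runge–Kutta method. -/
structure RungeKutta (s : ℕ) where
  A : Matrix (Fin s) (Fin s) ℝ
  b : Fin s → ℝ
  c : Fin s → ℝ

namespace RungeKutta

variable {s : ℕ} (rk : RungeKutta s)

/-- Collocation methods. The Lagrange polynomials are
`ℓᵢ(τ) = ∏_{j ≠ i} (τ - cⱼ)/(cᵢ - cⱼ)`. -/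
def IsCollocation : Prop :=
  Function.Injective rk.c ∧
  (∀ i j, rk.A i j = ∫ τ in (0 : ℝ)..rk.c i, (Lagrange.basis Finset.univ rk.c j).eval τ) ∧
  ∀ i, rk.b i = ∫ τ in (0 : ℝ)..1, (Lagrange.basis Finset.univ rk.c i).eval τ

/-- The matrix `I - λA`. -/
def resolventMatrix (z : ℂ) : Matrix (Fin s) (Fin s) ℂ := 1 - z • rk.A.map (↑)

/-- The row vector `λ bᵗ (I - λA)⁻¹`. -/
def stabRow (z : ℂ) : Fin s → ℂ :=
  z • Matrix.vecMul (fun i => (rk.b i : ℂ)) (rk.resolventMatrix z)⁻¹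

/-- The stability function `R(λ) = 1 + λ bᵗ (I - λA)⁻¹ 𝟙`. -/
def stabFun (z : ℂ) : ℂ := 1 + dotProduct (rk.stabRow z) 1

/-- `|R| ≤ 1` on `S`. -/
def StableOn (S : Set ℂ) : Prop := ∀ z ∈ S, ‖rk.stabFun z‖ ≤ 1

/-- `I - λA` is invertible and `λ bᵗ (I - λA)⁻¹` is uniformly bounded for `λ ∈ S`. -/
def RowStableOn (S : Set ℂ) : Prop :=
  (∀ z ∈ S, IsUnit (rk.resolventMatrix z)) ∧
  ∃ K : ℝ, ∀ z ∈ S, ∀ i, ‖rk.stabRow z i‖ ≤ K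

/-- `I - λA` is invertible and `(I - λA)⁻¹` is uniformly bounded for `λ ∈ S`. -/
def InvStableOn (S : Set ℂ) : Prop :=
  (∀ z ∈ S, IsUnit (rk.resolventMatrix z)) ∧
  ∃ K : ℝ, ∀ z ∈ S, ∀ i j, ‖(rk.resolventMatrix z)⁻¹ i j‖ ≤ K

/-- The closed left half-plane. -/
def leftHalfPlane : Set ℂ := {z | z.re ≤ 0}

/-- The imaginary axis. -/
def imaginaryAxis : Set ℂ := {z | z.re = 0}

/-- `Â`-stability: `A`-stable, `AS`-stable and `ASI`-stable. -/
def IsAHatStable : Prop :=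
  rk.StableOn leftHalfPlane ∧ rk.RowStableOn leftHalfPlane ∧ rk.InvStableOn leftHalfPlane

/-- `Î`-stability: `I`-stable, `IS`-stable and `ISI`-stable. -/
def IsIHatStable : Prop :=
  rk.StableOn imaginaryAxis ∧ rk.RowStableOn imaginaryAxis ∧ rk.InvStableOn imaginaryAxis

end RungeKutta

/-! ### The linearly implicit method -/

section Method

variable {s : ℕ}

/-- The step `Γₙ = D Γₙ₋₁ + Θ N(uₙ)` is strongly stable: the spectral radius of `D` is `< 1`. -/
def IsStronglyStable (D : Matrix (Fin s) (Fin s) ℂ) : Prop := spectralRadius ℂ D < 1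

/-- The step `Γₙ = D Γₙ₋₁ + Θ N(uₙ)` is consistent of order `s`: `V_c = D V_{c-𝟙} + ϑ`, where the
first column of `ϑ` is `Θ` and its other columns vanish. -/
def IsConsistent (c : Fin s → ℝ) (D : Matrix (Fin s) (Fin s) ℂ) (Θ : Fin s → ℂ) : Prop :=
  Matrix.vandermonde (fun i => (c i : ℂ)) =
    D * Matrix.vandermonde (fun i => (c i : ℂ) - 1) +
      Matrix.of fun i (j : Fin s) => if (j : ℕ) = 0 then Θ i else 0

variable {Ω : FourierDomain} {σ : ℝ}

/-- `Γₙ = D Γₙ₋₁ + Θ N(uₙ)`, where `γ = Γₙ₋₁` and `v = uₙ`. -/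
def gammaStep (D : Matrix (Fin s) (Fin s) ℂ) (Θ : Fin s → ℂ) (N : Ω.Sobolev σ → Ω.Sobolev σ)
    (γ : Fin s → Ω.Sobolev σ) (v : Ω.Sobolev σ) : Fin s → Ω.Sobolev σ :=
  fun i => ∑ j, D i j • γ j + Θ i • N v

/-- `(U₁,…,Uₛ) ∈ (H^σ)ˢ` solves `Uᵢ = v + h ∑ⱼ aᵢⱼ (L + γⱼ) Uⱼ` for all `i`; the identity between
elements of `H^(σ-2)` is expressed through Fourier transforms. -/
def IsStageSolution (rk : RungeKutta s) (L : LinearPart) (h : ℝ) (v : Ω.Sobolev σ)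
    (γ U : Fin s → Ω.Sobolev σ) : Prop :=
  ∃ G : Fin s → Ω.Sobolev σ, (∀ j, IsProduct (γ j) (U j) (G j)) ∧
    ∀ i, hat (U i) =
      hat v + (h : ℂ) • ∑ j, (rk.A i j : ℂ) • (L.applyHat (U j) + hat (G j))

/-- `v' = v + h ∑ᵢ bᵢ (L + γᵢ) Uᵢ` with `v' ∈ H^σ`. -/
def IsUpdate (rk : RungeKutta s) (L : LinearPart) (h : ℝ) (v : Ω.Sobolev σ)
    (γ U : Fin s → Ω.Sobolev σ) (v' : Ω.Sobolev σ) : Prop :=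
  ∃ G : Fin s → Ω.Sobolev σ, (∀ j, IsProduct (γ j) (U j) (G j)) ∧
    hat v' = hat v + (h : ℂ) • ∑ i, (rk.b i : ℂ) • (L.applyHat (U i) + hat (G i))

end Method

end

/-! The differential operator is removed by passing to Fourier multipliers. If `λ` runs through the
symbol of `hL`, the functions `(I - λA)⁻¹`, `λbᵗ(I - λA)⁻¹` and `R(λ)` define operators `P`, `Q`,
`R` on `H^σ`. The symbol takes its values in the stability region, so `P` and `Q` are bounded
independently of `h`, and `R` has norm at most one (`exists_stage_operators`). What remains of a
step are the products `γⱼUⱼ`, multiplied by `h`. They stay in `H^σ` because it is an algebra: the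
transforms of its elements are integrable when `σ > d/2`, and Young's inequality applies to the
weighted convolution (`exists_isProduct_of_characters`).

Hence for small `h` the stages are the fixed point of a contraction (`exists_step`). The exact
solution satisfies the same equations up to defects `O(h^(s+1))`, since collocation quadrature is
exact on polynomials of degree `< s`. Subtracting gives, for `aₙ = ‖u(tₙ) - uₙ‖` and the error `dₙ`
of `Γₙ₋₁`, the bound `aₙ₊₁ ≤ (1 + Ch)aₙ + C(h dₙ₊₁ + h^(s+1))` (`exists_step_error`). In a norm for
which `D` contracts by some `ρ < 1` (`IsStronglyStable.exists_contracting_norm`), consistency of the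
extrapolation gives `dₙ₊₁ ≤ ρdₙ + C(aₙ + h^s)`.

Both recursions hold only while `aₙ` and `dₙ` are small, because the constants depend on bounds for
`uₙ` and `Γₙ`. The combination `aₙ + κh dₙ`, with `κ` chosen so that the contraction by `ρ` pays for
the coupling, obeys a scalar Gronwall inequality. For small data and small `h` it never reaches the
thresholds, so the argument closes by induction (`discrete_gronwall_bootstrap`). -/

open FourierDomain FourierDomain.Sobolev

/-! ### Young's inequality and the algebra property of `H^σ` -/

section

open scoped ENNReal Convolution

/-- Young's inequality `L² * L¹ → L²` for non-negative functions. -/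
theorem eLpNorm_two_lintegral_mul_sub_le {G : Type*} [MeasurableSpace G] [AddCommGroup G]
    [MeasurableAdd₂ G] [MeasurableNeg G] {ν : Measure G} [SFinite ν] [ν.IsAddLeftInvariant]
    [ν.IsNegInvariant] {a b : G → ℝ≥0∞} (ha : Measurable a) (hb : Measurable b) :
    eLpNorm (fun x => ∫⁻ y, a y * b (x - y) ∂ν) 2 ν ≤ eLpNorm a 2 ν * ∫⁻ y, b y ∂ν := by
  have hab : Measurable fun p : G × G => b (p.1 - p.2) :=
    hb.comp (measurable_fst.sub measurable_snd)
  have hbx : ∀ x, Measurable fun y => b (x - y) := fun x => hb.comp (measurable_const.sub measurable_id)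
  have hinv : ∀ x, ∫⁻ y, b (x - y) ∂ν = ∫⁻ y, b y ∂ν := fun x => lintegral_sub_left_eq_self b x
  have hinv' : ∀ y, ∫⁻ x, b (x - y) ∂ν = ∫⁻ y, b y ∂ν := fun x => lintegral_sub_right_eq_self b x
  -- Cauchy–Schwarz for the splitting `a b = (a b^(1/2)) b^(1/2)`. Integrating in `x` and exchanging
  -- the integrals then leaves only translates of `b`, all with the same integral.
  have key : ∀ x, (∫⁻ y, a y * b (x - y) ∂ν) ^ (2 : ℝ) ≤
      (∫⁻ y, a y ^ (2 : ℝ) * b (x - y) ∂ν) * ∫⁻ y, b y ∂ν := by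
    intro x
    have h := ENNReal.lintegral_mul_le_Lp_mul_Lq ν Real.HolderConjugate.two_two
      (f := fun y => a y * b (x - y) ^ (1 / 2 : ℝ)) (g := fun y => b (x - y) ^ (1 / 2 : ℝ))
      (ha.mul ((hbx x).pow_const _)).aemeasurable ((hbx x).pow_const _).aemeasurable
    have h2 : ∀ z : ℝ≥0∞, z ^ (1 / 2 : ℝ) * z ^ (1 / 2 : ℝ) = z := fun z => by
      rw [← ENNReal.rpow_add_of_nonneg _ _ (by norm_num) (by norm_num)]; norm_num
    have h3 : ∀ z : ℝ≥0∞, (z ^ (1 / 2 : ℝ)) ^ (2 : ℝ) = z := fun z => by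
      rw [← ENNReal.rpow_mul]; norm_num
    simp only [Pi.mul_apply, mul_assoc, h2, ENNReal.mul_rpow_of_nonneg _ _ zero_le_two, h3] at h
    rw [hinv, ← ENNReal.mul_rpow_of_nonneg _ _ (by norm_num)] at h
    calc _ ≤ _ := ENNReal.rpow_le_rpow h zero_le_two
      _ = _ := h3 _
  rw [eLpNorm_eq_lintegral_rpow_enorm_toReal (by norm_num) (by norm_num),
    eLpNorm_eq_lintegral_rpow_enorm_toReal (by norm_num) (by norm_num)]
  simp only [enorm_eq_self, ENNReal.toReal_ofNat]
  have h4 : ∫⁻ y, b y ∂ν = ((∫⁻ y, b y ∂ν) ^ (2 : ℝ)) ^ (1 / 2 : ℝ) := by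
    rw [← ENNReal.rpow_mul]; norm_num
  rw [h4, ← ENNReal.mul_rpow_of_nonneg _ _ (by norm_num)]
  refine ENNReal.rpow_le_rpow ?_ (by norm_num)
  calc _ ≤ ∫⁻ x, (∫⁻ y, a y ^ (2 : ℝ) * b (x - y) ∂ν) * ∫⁻ y, b y ∂ν ∂ν := lintegral_mono key
    _ = (∫⁻ x, (∫⁻ y, a y ^ (2 : ℝ) * b (x - y) ∂ν) ∂ν) * ∫⁻ y, b y ∂ν := by
        refine lintegral_mul_const _ (Measurable.lintegral_prod_right'
          (f := fun p : G × G => a p.2 ^ (2 : ℝ) * b (p.1 - p.2)) ?_)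
        exact ((ha.comp measurable_snd).pow_const _).mul hab
    _ = (∫⁻ y, ∫⁻ x, a y ^ (2 : ℝ) * b (x - y) ∂ν ∂ν) * ∫⁻ y, b y ∂ν := by
        rw [lintegral_lintegral_swap]
        exact (((ha.comp measurable_snd).pow_const _).mul hab).aemeasurable
    _ = _ := by
        have h5 : ∀ y, ∫⁻ x, a y ^ (2 : ℝ) * b (x - y) ∂ν = a y ^ (2 : ℝ) * ∫⁻ y, b y ∂ν :=
          fun y => by
            have h6 : Measurable fun x => b (x - y) := hb.comp (measurable_id.sub_const y)
            rw [lintegral_const_mul _ h6, hinv']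
        simp_rw [h5]
        rw [lintegral_mul_const _ (ha.pow_const _), mul_assoc, ENNReal.rpow_two, sq]

namespace FourierDomain

variable {Ω : FourierDomain} {σ : ℝ}

theorem Sobolev.hat_injective : Function.Injective (Sobolev.hat (Ω := Ω) (σ := σ)) :=
  fun _ _ h => Subtype.ext (Ω.hat_injective h)

theorem Sobolev.norm_eq_eLpNorm (f : Ω.Sobolev σ) :
    ‖f‖ = (eLpNorm (fun ξ => (((1 + Ω.sqFreq ξ) ^ (σ / 2) : ℝ) : ℂ) * hat f ξ) 2 Ω.ν).toReal := by
  rw [show ‖f‖ = ‖toWeightedL2 f‖ from rfl, Lp.norm_def]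
  exact congrArg _ (eLpNorm_congr_ae (toWeightedL2_coeFn f))

theorem Sobolev.memLp_weight_mul_hat (f : Ω.Sobolev σ) :
    MemLp (fun ξ => (((1 + Ω.sqFreq ξ) ^ (σ / 2) : ℝ) : ℂ) * hat f ξ) 2 Ω.ν :=
  (Lp.memLp (toWeightedL2 f)).ae_eq (toWeightedL2_coeFn f)

theorem Sobolev.eLpNorm_weight_mul_hat (f : Ω.Sobolev σ) :
    eLpNorm (fun ξ => (((1 + Ω.sqFreq ξ) ^ (σ / 2) : ℝ) : ℂ) * hat f ξ) 2 Ω.ν =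
      ENNReal.ofReal ‖f‖ := by
  rw [norm_eq_eLpNorm, ENNReal.ofReal_toReal (memLp_weight_mul_hat f).2.ne]

theorem one_le_weight (hσ : 0 ≤ σ) (ξ : Ω.Freq) : 1 ≤ (1 + Ω.sqFreq ξ) ^ (σ / 2) :=
  Real.one_le_rpow (by linarith [Ω.sqFreq_nonneg ξ]) (by linarith)

theorem measurable_weight (σ : ℝ) : Measurable fun ξ => (1 + Ω.sqFreq ξ) ^ (σ / 2) :=
  (Ω.sqFreq_measurable.const_add 1).pow_const _

/-- A frequency profile in the weighted `L²` space is the Fourier transform of an element of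
`H^σ`. -/
theorem Sobolev.exists_hat_eq (hσ : 0 ≤ σ) (hsurj : ∀ F : Lp ℂ 2 Ω.ν, ∃ p, Ω.hat p = F)
    (H : Ω.Freq →ₘ[Ω.ν] ℂ)
    (hH : MemLp (fun ξ => (((1 + Ω.sqFreq ξ) ^ (σ / 2) : ℝ) : ℂ) * H ξ) 2 Ω.ν) :
    ∃ f : Ω.Sobolev σ, hat f = H := by
  have hH2 : MemLp H 2 Ω.ν := by
    refine hH.of_le H.aestronglyMeasurable (Filter.Eventually.of_forall fun ξ => ?_)
    rw [norm_mul, Complex.norm_real, Real.norm_of_nonneg (zero_le_one.trans (one_le_weight hσ ξ))]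
    exact le_mul_of_one_le_left (norm_nonneg _) (one_le_weight hσ ξ)
  obtain ⟨p, hp⟩ := hsurj (hH2.toLp H)
  have hp' : Ω.hat p = H := by
    rw [hp]
    exact AEEqFun.ext hH2.coeFn_toLp
  refine ⟨⟨p, ?_⟩, hp'⟩
  change Ω.weightedHat σ p ∈ Lp.LpSubmodule ℂ ℂ 2 Ω.ν
  have : Ω.weightedHat σ p =ᵐ[Ω.ν] fun ξ => (((1 + Ω.sqFreq ξ) ^ (σ / 2) : ℝ) : ℂ) * H ξ := by
    change (AEEqFun.mk _ _ * Ω.hat p : Ω.Freq →ₘ[Ω.ν] ℂ) =ᵐ[Ω.ν] _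
    rw [hp']
    refine (AEEqFun.coeFn_mul _ _).trans ?_
    filter_upwards [AEEqFun.coeFn_mk (μ := Ω.ν)
      (fun ξ => (((1 + Ω.sqFreq ξ) ^ (σ / 2) : ℝ) : ℂ))
      (Complex.measurable_ofReal.comp (measurable_weight σ)).aestronglyMeasurable] with ξ hξ
    simp only [Pi.mul_apply, hξ]
  exact Lp.mem_Lp_iff_memLp.mpr (hH.ae_eq this.symm)

/-- Cauchy–Schwarz after inserting the weight and its inverse. The inverse weight is square
integrable exactly in the range `σ > d/2`, and this is where that assumption enters. -/
theorem Sobolev.eLpNorm_one_hat_le (f : Ω.Sobolev σ) :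
    eLpNorm (hat f) 1 Ω.ν ≤
      eLpNorm (fun ξ => (1 + Ω.sqFreq ξ) ^ (-σ / 2)) 2 Ω.ν * ENNReal.ofReal ‖f‖ := by
  rw [← eLpNorm_weight_mul_hat f]
  refine le_trans (le_of_eq ?_) (eLpNorm_smul_le_mul_eLpNorm (p := 2) (q := 2) (r := 1)
    (memLp_weight_mul_hat f).1
    ((Ω.sqFreq_measurable.const_add 1).pow_const (-σ / 2)).aestronglyMeasurable)
  congr 1
  ext ξ
  have h0 : 0 < 1 + Ω.sqFreq ξ := by linarith [Ω.sqFreq_nonneg ξ]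
  simp only [Pi.smul_apply', Complex.real_smul]
  rw [← mul_assoc, ← Complex.ofReal_mul, ← Real.rpow_add h0]
  simp [neg_div]

/-- `H^σ` is an algebra under pointwise multiplication, for a Fourier domain whose frequencies form
a group of characters, with Fourier inversion and a square integrable inverse weight. -/
theorem Sobolev.exists_isProduct_of_characters [AddCommGroup Ω.Freq] [MeasurableAdd₂ Ω.Freq]
    [MeasurableNeg Ω.Freq] [SFinite Ω.ν] [Ω.ν.IsAddLeftInvariant] [Ω.ν.IsNegInvariant]
    (hσ : 0 ≤ σ) (hsurj : ∀ F : Lp ℂ 2 Ω.ν, ∃ p, Ω.hat p = F)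
    (e : Ω.Freq → Ω.Pt → ℂ) (he_meas : ∀ x, Measurable fun ξ => e ξ x)
    (he_add : ∀ ξ η x, e (ξ + η) x = e ξ x * e η x) (he_norm : ∀ ξ x, ‖e ξ x‖ = 1)
    (hinv : ∀ p : Lp ℂ 2 Ω.μ, Integrable (Ω.hat p) Ω.ν →
      p =ᵐ[Ω.μ] fun x => ∫ ξ, Ω.hat p ξ * e ξ x ∂Ω.ν)
    (hw : MemLp (fun ξ => (1 + Ω.sqFreq ξ) ^ (-σ / 2)) 2 Ω.ν) (c : ℝ)
    (hc : ∀ ξ η, (1 + Ω.sqFreq (ξ + η)) ^ (σ / 2) ≤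
      c * ((1 + Ω.sqFreq ξ) ^ (σ / 2) + (1 + Ω.sqFreq η) ^ (σ / 2))) :
    ∃ K : ℝ, 0 ≤ K ∧ ∀ f g : Ω.Sobolev σ, ∃ w, IsProduct f g w ∧ ‖w‖ ≤ K * ‖f‖ * ‖g‖ := by
  set κ : ℝ := (eLpNorm (fun ξ => (1 + Ω.sqFreq ξ) ^ (-σ / 2)) 2 Ω.ν).toReal with hκ
  have hκ' : eLpNorm (fun ξ => (1 + Ω.sqFreq ξ) ^ (-σ / 2)) 2 Ω.ν = ENNReal.ofReal κ :=
    (ENNReal.ofReal_toReal hw.2.ne).symm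
  -- At frequency zero the hypothesis reads `w ≤ 2cw` with `w ≥ 1`.
  have hc0 : 0 ≤ c := by
    have h1 := hc 0 0
    have h2 := one_le_weight hσ (0 : Ω.Freq)
    rw [add_zero] at h1
    nlinarith
  refine ⟨2 * c * κ, by positivity, fun f g => ?_⟩
  set W : Ω.Freq → ℝ := fun ξ => (1 + Ω.sqFreq ξ) ^ (σ / 2) with hW
  have hWm : Measurable W := measurable_weight σ
  have hint : ∀ f : Ω.Sobolev σ, Integrable (hat f) Ω.ν := fun f =>
    memLp_one_iff_integrable.mp ⟨(hat f).aestronglyMeasurable,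
      (eLpNorm_one_hat_le f).trans_lt (ENNReal.mul_lt_top hw.2 ENNReal.ofReal_lt_top)⟩
  set H : Ω.Freq → ℂ := (hat f ⋆[ContinuousLinearMap.mul ℂ ℂ, Ω.ν] hat g) with hH
  have hHi : Integrable H Ω.ν := (hint f).integrable_convolution _ (hint g)
  have hmeas : ∀ f : Ω.Sobolev σ, Measurable (fun ξ => ‖hat f ξ‖ₑ) := fun f =>
    (hat f).stronglyMeasurable.measurable.enorm
  have hWe : Measurable fun ξ => ‖W ξ‖ₑ := hWm.enorm
  have hW0 : ∀ ξ, 0 ≤ W ξ := fun ξ => zero_le_one.trans (one_le_weight hσ ξ)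
  have hen : ∀ x : ℝ, ‖(x : ℂ)‖ₑ = ‖x‖ₑ := fun x => by
    rw [← ofReal_norm, Complex.norm_real, ofReal_norm]
  -- The weight at `ξ = η + (ξ - η)` is split by `hc`, so that each of the two convolutions carries
  -- the weight on one factor only. The substitution `η ↦ ξ - η` puts the weighted factor first in
  -- both.
  have hHb : ∀ ξ, ‖((W ξ : ℝ) : ℂ) * H ξ‖ₑ ≤ ENNReal.ofReal c *
      ((∫⁻ η, (‖W η‖ₑ * ‖hat f η‖ₑ) * ‖hat g (ξ - η)‖ₑ ∂Ω.ν) +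
        ∫⁻ η, (‖W η‖ₑ * ‖hat g η‖ₑ) * ‖hat f (ξ - η)‖ₑ ∂Ω.ν) := by
    intro ξ
    have e1 : ∫⁻ η, (‖W η‖ₑ * ‖hat g η‖ₑ) * ‖hat f (ξ - η)‖ₑ ∂Ω.ν =
        ∫⁻ η, (‖W (ξ - η)‖ₑ * ‖hat g (ξ - η)‖ₑ) * ‖hat f η‖ₑ ∂Ω.ν := by
      rw [← lintegral_sub_left_eq_self _ ξ]
      simp
    rw [e1, ← lintegral_add_left, ← lintegral_const_mul]
    · rw [enorm_mul, hen]
      calc _ ≤ ‖W ξ‖ₑ * ∫⁻ η, ‖hat f η‖ₑ * ‖hat g (ξ - η)‖ₑ ∂Ω.ν := by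
            gcongr
            refine (enorm_integral_le_lintegral_enorm _).trans (le_of_eq ?_)
            simp
        _ = ∫⁻ η, ‖W ξ‖ₑ * (‖hat f η‖ₑ * ‖hat g (ξ - η)‖ₑ) ∂Ω.ν := by
            rw [lintegral_const_mul]
            exact (hmeas f).mul ((hmeas g).comp (measurable_const.sub measurable_id))
        _ ≤ _ := by
            refine lintegral_mono fun η => ?_
            have h1 : ‖W ξ‖ₑ ≤ ENNReal.ofReal c * (‖W η‖ₑ + ‖W (ξ - η)‖ₑ) := by
              rw [Real.enorm_of_nonneg (hW0 _), Real.enorm_of_nonneg (hW0 _),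
                Real.enorm_of_nonneg (hW0 _), ← ENNReal.ofReal_add (hW0 _) (hW0 _),
                ← ENNReal.ofReal_mul hc0]
              refine ENNReal.ofReal_le_ofReal ?_
              have := hc η (ξ - η)
              rwa [add_sub_cancel] at this
            calc _ ≤ (ENNReal.ofReal c * (‖W η‖ₑ + ‖W (ξ - η)‖ₑ)) *
                  (‖hat f η‖ₑ * ‖hat g (ξ - η)‖ₑ) := by gcongr
              _ = _ := by ring
    · have h1 : Measurable fun η : Ω.Freq => ξ - η := measurable_const.sub measurable_id
      exact ((hWe.mul (hmeas f)).mul ((hmeas g).comp h1)).add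
        (((hWe.comp h1).mul ((hmeas g).comp h1)).mul (hmeas f))
    · exact (hWe.mul (hmeas f)).mul ((hmeas g).comp (measurable_const.sub measurable_id))
  -- The weighted factor is in `L²` with norm `‖f‖`, the other one in `L¹` with norm at most `κ‖g‖`.
  have young : ∀ f g : Ω.Sobolev σ,
      eLpNorm (fun ξ => ∫⁻ η, (‖W η‖ₑ * ‖hat f η‖ₑ) * ‖hat g (ξ - η)‖ₑ ∂Ω.ν) 2 Ω.ν ≤
        ENNReal.ofReal (κ * ‖f‖ * ‖g‖) := by
    intro f g
    refine (eLpNorm_two_lintegral_mul_sub_le (hWe.mul (hmeas f)) (hmeas g)).trans ?_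
    have h1 : eLpNorm (fun η => ‖W η‖ₑ * ‖hat f η‖ₑ) 2 Ω.ν = ENNReal.ofReal ‖f‖ := by
      rw [← eLpNorm_weight_mul_hat f, ← eLpNorm_enorm]
      refine congrArg (fun F => eLpNorm F 2 Ω.ν) (funext fun ξ => ?_)
      change ‖W ξ‖ₑ * ‖hat f ξ‖ₑ = ‖(W ξ : ℂ) * hat f ξ‖ₑ
      rw [enorm_mul, hen]
    have h2 := eLpNorm_one_hat_le g
    rw [eLpNorm_one_eq_lintegral_enorm, hκ'] at h2
    calc _ ≤ ENNReal.ofReal ‖f‖ * (ENNReal.ofReal κ * ENNReal.ofReal ‖g‖) := by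
          gcongr
          exact h1.le
      _ = _ := by
          rw [mul_comm κ, mul_assoc, ENNReal.ofReal_mul (norm_nonneg _),
            ENNReal.ofReal_mul ENNReal.toReal_nonneg]
  have hmeasI : ∀ f g : Ω.Sobolev σ, Measurable
      fun ξ => ∫⁻ η, (‖W η‖ₑ * ‖hat f η‖ₑ) * ‖hat g (ξ - η)‖ₑ ∂Ω.ν := fun f g =>
    Measurable.lintegral_prod_right'
      (f := fun p : Ω.Freq × Ω.Freq => (‖W p.2‖ₑ * ‖hat f p.2‖ₑ) * ‖hat g (p.1 - p.2)‖ₑ)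
      (((hWe.mul (hmeas f)).comp measurable_snd).mul
        ((hmeas g).comp (measurable_fst.sub measurable_snd)))
  have hbound : eLpNorm (fun ξ => ((W ξ : ℝ) : ℂ) * H ξ) 2 Ω.ν ≤
      ENNReal.ofReal (2 * c * κ * ‖f‖ * ‖g‖) := by
    refine (eLpNorm_le_nnreal_smul_eLpNorm_of_ae_le_mul' (c := c.toNNReal) (g := fun ξ =>
      ((∫⁻ η, (‖W η‖ₑ * ‖hat f η‖ₑ) * ‖hat g (ξ - η)‖ₑ ∂Ω.ν) +
        ∫⁻ η, (‖W η‖ₑ * ‖hat g η‖ₑ) * ‖hat f (ξ - η)‖ₑ ∂Ω.ν))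
      (Filter.Eventually.of_forall hHb) 2).trans ?_
    rw [ENNReal.smul_def, smul_eq_mul]
    calc _ ≤ ENNReal.ofReal c * (ENNReal.ofReal (κ * ‖f‖ * ‖g‖) +
          ENNReal.ofReal (κ * ‖g‖ * ‖f‖)) := by
          refine mul_le_mul_right ((eLpNorm_add_le (hmeasI f g).aestronglyMeasurable
            (hmeasI g f).aestronglyMeasurable one_le_two).trans ?_) _
          exact add_le_add (young f g) (young g f)
      _ = _ := by
          have hκ0 : 0 ≤ κ := ENNReal.toReal_nonneg
          rw [← ENNReal.ofReal_add (by positivity) (by positivity), ← ENNReal.ofReal_mul hc0]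
          congr 1
          ring
  have hHm : MemLp (fun ξ => ((W ξ : ℝ) : ℂ) * H ξ) 2 Ω.ν :=
    ⟨((Complex.measurable_ofReal.comp hWm).aestronglyMeasurable).mul hHi.1,
      hbound.trans_lt ENNReal.ofReal_lt_top⟩
  have hmk : AEEqFun.mk H hHi.1 =ᵐ[Ω.ν] H := AEEqFun.coeFn_mk _ _
  obtain ⟨w, hw'⟩ := exists_hat_eq hσ hsurj (AEEqFun.mk H hHi.1)
    (hHm.ae_eq (by filter_upwards [hmk] with ξ hξ; rw [hξ]))
  refine ⟨w, ?_, ?_⟩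
  · have hinv' : ∀ f : Ω.Sobolev σ, toL2 f =ᵐ[Ω.μ] fun x => ∫ ξ, hat f ξ * e ξ x ∂Ω.ν :=
      fun f => hinv (toL2 f) (hint f)
    have hie : ∀ (f : Ω.Sobolev σ) x, Integrable (fun ξ => hat f ξ * e ξ x) Ω.ν := fun f x =>
      (hint f).mul_bdd (he_meas x).aestronglyMeasurable
        (Filter.Eventually.of_forall fun ξ => (he_norm ξ x).le)
    filter_upwards [hinv' f, hinv' g, hinv' w] with x hf hg hw''
    rw [hf, hg, hw'', hw']
    -- By inversion, `f(x)g(x)` is a product of two integrals, hence the integral of the convolution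
    -- of the twisted transforms. The character `e · x` is multiplicative, so it factors out of this
    -- convolution and leaves the transform `H` of `w`.
    rw [← ContinuousLinearMap.mul_apply' ℂ ℂ, ← integral_convolution _ (hie f x) (hie g x)]
    refine integral_congr_ae ?_
    filter_upwards [hmk] with ξ hξ
    rw [hξ, hH, convolution_def, convolution_def, ← integral_mul_const]
    refine integral_congr_ae (Filter.Eventually.of_forall fun η => ?_)
    have h1 : e ξ x = e η x * e (ξ - η) x := by rw [← he_add, add_sub_cancel]
    simp only [ContinuousLinearMap.mul_apply', h1]
    ring
  · rw [norm_eq_eLpNorm, hw']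
    refine ENNReal.toReal_le_of_le_ofReal (by positivity) (le_trans (le_of_eq ?_) hbound)
    exact eLpNorm_congr_ae (by filter_upwards [hmk] with ξ hξ; rw [hξ])

end FourierDomain

end

/-! ### Fourier inversion and the algebra property on `ℝᵈ` and `𝕋ᵈ` -/

section

open scoped ENNReal FourierTransform ContDiff InnerProductSpace

/-- Fubini for the symmetric kernel `exp(2πi x·ξ)`; the inverse transform is the Fourier integral
for the pairing `-⟪x, ξ⟫`, which is its own flip. -/
theorem integral_fourierInv_smul_eq_of_integrable {V : Type*} [NormedAddCommGroup V]
    [InnerProductSpace ℝ V] [MeasurableSpace V] [BorelSpace V] [FiniteDimensional ℝ V]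
    {f g : V → ℂ} (hf : Integrable f) (hg : Integrable g) :
    ∫ ξ, 𝓕⁻ f ξ • g ξ = ∫ x, f x • 𝓕⁻ g x := by
  have h := VectorFourier.integral_fourierIntegral_smul_eq_flip (L := -innerₗ V)
    (μ := volume) (ν := volume) Real.continuous_fourierChar
    (continuous_inner (𝕜 := ℝ) (E := V)).neg hf hg
  have hflip : (-innerₗ V).flip = -innerₗ V := by
    ext x y
    simp [real_inner_comm]
  rw [hflip] at h
  exact h

/-- `L²` Fourier inversion for functions with integrable Fourier transform. -/
theorem Lp_ae_eq_fourierInv_of_integrable {V : Type*} [NormedAddCommGroup V]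
    [InnerProductSpace ℝ V] [MeasurableSpace V] [BorelSpace V] [FiniteDimensional ℝ V]
    (p : Lp (α := V) ℂ 2 volume) (hp : Integrable (𝓕 p : Lp (α := V) ℂ 2 volume)) :
    p =ᵐ[volume] 𝓕⁻ ((𝓕 p : Lp (α := V) ℂ 2 volume) : V → ℂ) := by
  set H : Lp (α := V) ℂ 2 volume := 𝓕 p with hH
  have hcont : Continuous (𝓕⁻ (H : V → ℂ)) := by
    have h := VectorFourier.fourierIntegral_continuous (L := -innerₗ V) (μ := volume)
      Real.continuous_fourierChar (continuous_inner (𝕜 := ℝ) (E := V)).neg hp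
    exact h
  -- The two locally integrable functions are compared by testing against smooth compactly supported
  -- functions. As a tempered distribution `p` is the inverse transform of `H`, which moves `𝓕⁻`
  -- onto the test function; integrability of `H` allows it to be moved back as a pointwise
  -- integral.
  refine ae_eq_of_integral_contDiff_smul_eq ((Lp.memLp p).locallyIntegrable one_le_two)
    hcont.locallyIntegrable fun g hg hgs => ?_
  have hg' : ContDiff ℝ ∞ fun x => (g x : ℂ) := Complex.ofRealCLM.contDiff.comp hg
  have hgs' : HasCompactSupport fun x => (g x : ℂ) := hgs.comp_left Complex.ofReal_zero
  set φ : SchwartzMap V ℂ := hgs'.toSchwartzMap hg' with hφ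
  have hφv : ∀ x, φ x = (g x : ℂ) := fun x => rfl
  have h1 := Lp.fourierInv_toTemperedDistribution_eq H
  rw [hH, FourierTransform.fourierInv_fourier_eq, ← hH] at h1
  have h2 := congrArg (fun F => F φ) h1
  simp only [TemperedDistribution.fourierInv_apply, Lp.toTemperedDistribution_apply] at h2
  have h3 := integral_fourierInv_smul_eq_of_integrable φ.integrable hp
  rw [← SchwartzMap.fourierInv_coe] at h3
  rw [h3] at h2
  simpa [hφv] using h2.symm

/-- The hypothesis gives `1 + c ≤ 4(1 + max a b)`, and a power of a maximum is at most the sum of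
the powers. With squared frequency lengths for `a`, `b`, `c`, this is the subadditivity of the
Sobolev weight up to a constant. -/
theorem weight_add_le {a b c σ : ℝ} (hσ : 0 ≤ σ) (ha : 0 ≤ a) (hb : 0 ≤ b)
    (hc : 0 ≤ c) (h : c ≤ 2 * a + 2 * b) :
    (1 + c) ^ (σ / 2) ≤ 4 ^ (σ / 2) * ((1 + a) ^ (σ / 2) + (1 + b) ^ (σ / 2)) := by
  have hmax : (1 + max a b) ^ (σ / 2) ≤ (1 + a) ^ (σ / 2) + (1 + b) ^ (σ / 2) := by
    rcases max_cases a b with ⟨h, -⟩ | ⟨h, -⟩ <;> rw [h]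
    · exact le_add_of_nonneg_right (by positivity)
    · exact le_add_of_nonneg_left (by positivity)
  calc (1 + c) ^ (σ / 2) ≤ (4 * (1 + max a b)) ^ (σ / 2) := by
        refine Real.rpow_le_rpow (by linarith) ?_ (by linarith)
        linarith [le_max_left a b, le_max_right a b]
    _ = 4 ^ (σ / 2) * (1 + max a b) ^ (σ / 2) :=
        Real.mul_rpow (by norm_num) (by linarith [ha.trans (le_max_left a b)])
    _ ≤ _ := by gcongr

namespace FourierDomain

theorem wholeSpace_hat_surjective (d : ℕ) (F : Lp ℂ 2 (wholeSpace d).ν) :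
    ∃ p, (wholeSpace d).hat p = F :=
  ⟨(Lp.fourierTransformₗᵢ (EuclideanSpace ℝ (Fin d)) ℂ).symm F,
    congrArg Subtype.val ((Lp.fourierTransformₗᵢ (EuclideanSpace ℝ (Fin d)) ℂ).apply_symm_apply F)⟩

theorem wholeSpace_exists_isProduct (d : ℕ) {σ : ℝ} (hσ : (d : ℝ) / 2 < σ) :
    ∃ K : ℝ, 0 ≤ K ∧ ∀ f g : (wholeSpace d).Sobolev σ,
      ∃ w, IsProduct f g w ∧ ‖w‖ ≤ K * ‖f‖ * ‖g‖ := by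
  have hσ0 : 0 ≤ σ := le_trans (by positivity) hσ.le
  let _ : AddCommGroup (wholeSpace d).Freq :=
    (inferInstance : AddCommGroup (EuclideanSpace ℝ (Fin d)))
  have _ : MeasurableAdd₂ (wholeSpace d).Freq :=
    (inferInstance : MeasurableAdd₂ (EuclideanSpace ℝ (Fin d)))
  have _ : MeasurableNeg (wholeSpace d).Freq :=
    (inferInstance : MeasurableNeg (EuclideanSpace ℝ (Fin d)))
  have _ : SFinite (wholeSpace d).ν :=
    (inferInstance : SFinite (volume : Measure (EuclideanSpace ℝ (Fin d))))
  have _ : (wholeSpace d).ν.IsAddLeftInvariant :=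
    (inferInstance : (volume : Measure (EuclideanSpace ℝ (Fin d))).IsAddLeftInvariant)
  have _ : (wholeSpace d).ν.IsNegInvariant :=
    (inferInstance : (volume : Measure (EuclideanSpace ℝ (Fin d))).IsNegInvariant)
  refine Sobolev.exists_isProduct_of_characters hσ0 (wholeSpace_hat_surjective d)
    (fun (ξ x : EuclideanSpace ℝ (Fin d)) => (Real.fourierChar ⟪ξ, x⟫_ℝ : ℂ)) ?_ ?_ ?_ ?_ ?_
    (4 ^ (σ / 2)) ?_
  · intro x
    have : Continuous fun ξ : EuclideanSpace ℝ (Fin d) => (Real.fourierChar ⟪ξ, x⟫_ℝ : ℂ) :=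
      continuous_subtype_val.comp (Real.continuous_fourierChar.comp
        (continuous_id.inner continuous_const))
    exact this.measurable
  · intro (ξ : EuclideanSpace ℝ (Fin d)) (η : EuclideanSpace ℝ (Fin d))
      (x : EuclideanSpace ℝ (Fin d))
    change (Real.fourierChar ⟪ξ + η, x⟫_ℝ : ℂ) = _
    rw [inner_add_left, AddChar.map_add_eq_mul, Circle.coe_mul]
  · intro ξ x
    exact Circle.norm_coe _
  · intro p hp
    refine (Lp_ae_eq_fourierInv_of_integrable (V := EuclideanSpace ℝ (Fin d)) p hp).trans ?_
    refine Filter.Eventually.of_forall fun x => ?_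
    refine (Real.fourierInv_eq _ x).trans ?_
    refine integral_congr_ae (Filter.Eventually.of_forall fun ξ => ?_)
    simp only [Circle.smul_def, smul_eq_mul]
    exact mul_comm _ _
  · change MemLp (fun η : EuclideanSpace ℝ (Fin d) =>
      (1 + ‖(2 * Real.pi) • η‖ ^ 2) ^ (-σ / 2)) 2 volume
    rw [memLp_two_iff_integrable_sq (Measurable.aestronglyMeasurable (by fun_prop))]
    -- The square of the inverse weight is `(1 + |x|²)^(-r/2)` with `r = 2σ > d`, dilated by `2π`.
    have h1 := integrable_rpow_neg_one_add_norm_sq (E := EuclideanSpace ℝ (Fin d)) (μ := volume)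
      (r := 2 * σ) (by rw [finrank_euclideanSpace_fin]; linarith)
    refine (h1.comp_smul (R := 2 * Real.pi) (by positivity)).congr
      (Filter.Eventually.of_forall fun η => ?_)
    simp only
    rw [← Real.rpow_natCast (_ ^ (-σ / 2)), ← Real.rpow_mul (by positivity)]
    congr 1
    push_cast
    ring
  · intro (ξ : EuclideanSpace ℝ (Fin d)) (η : EuclideanSpace ℝ (Fin d))
    refine weight_add_le hσ0 ((wholeSpace d).sqFreq_nonneg _) ((wholeSpace d).sqFreq_nonneg _)
      ((wholeSpace d).sqFreq_nonneg _) ?_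
    change ‖(2 * Real.pi) • (ξ + η)‖ ^ 2 ≤
      2 * ‖(2 * Real.pi) • ξ‖ ^ 2 + 2 * ‖(2 * Real.pi) • η‖ ^ 2
    rw [smul_add]
    generalize (2 * Real.pi) • ξ = a
    generalize (2 * Real.pi) • η = b
    nlinarith [norm_add_le a b, norm_nonneg (a + b), norm_nonneg a, norm_nonneg b,
      sq_nonneg (‖a‖ - ‖b‖)]

theorem torus_hat_apply (d : ℕ) (p : Lp ℂ 2 (torus d).μ) (k : Fin d → ℤ) :
    (torus d).hat p k = UnitAddTorus.mFourierCoeff p k := by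
  have h := AEEqFun.coeFn_mk (μ := (Measure.count : Measure (Fin d → ℤ)))
    (fun k => UnitAddTorus.mFourierCoeff p k)
    (measurable_of_countable _).aestronglyMeasurable
  rw [Filter.EventuallyEq, Measure.ae_count_iff] at h
  exact h k

theorem torus_hat_surjective (d : ℕ) (F : Lp ℂ 2 (torus d).ν) :
    ∃ p, (torus d).hat p = F := by
  have h1 : Memℓp (fun k : Fin d → ℤ => F k) 2 := by
    have h := (memLp_two_iff_integrable_sq_norm (Lp.memLp F).1).1 (Lp.memLp F)
    change Integrable (fun x : Fin d → ℤ => ‖F x‖ ^ 2) Measure.count at h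
    rw [integrable_count_iff] at h
    refine memℓp_gen ?_
    simpa using h
  refine ⟨UnitAddTorus.mFourierBasis.repr.symm ⟨fun k => F k, h1⟩, AEEqFun.ext ?_⟩
  refine Filter.Eventually.of_forall fun k => ?_
  refine (torus_hat_apply d _ k).trans ?_
  refine (UnitAddTorus.mFourierBasis_repr _ k).symm.trans ?_
  rw [LinearIsometryEquiv.apply_symm_apply]

/-- Comparison with the lattice sum of `‖k‖^(-2σ)` over `ℤᵈ` in the sup norm, which is dominated by
the Euclidean norm and converges because `2σ > d`. -/
theorem summable_one_add_sum_sq_rpow (d : ℕ) {σ : ℝ} (hσ : (d : ℝ) / 2 < σ) :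
    Summable fun k : Fin d → ℤ => (1 + ∑ j, (k j : ℝ) ^ 2) ^ (-σ) := by
  have hσ0 : 0 < σ := lt_of_le_of_lt (by positivity) hσ
  set L := Submodule.span ℤ (Set.range (Pi.basisFun ℝ (Fin d)))
  have hL : ∀ k : Fin d → ℤ, (fun j => (k j : ℝ)) ∈ L := fun k => by
    have : (fun j => (k j : ℝ)) = ∑ j, k j • Pi.basisFun ℝ (Fin d) j := by
      ext i
      simp [Finset.sum_apply, Pi.single_apply]
    rw [this]
    exact Submodule.sum_mem _ fun j _ => Submodule.smul_mem _ _
      (Submodule.subset_span (mem_range_self j))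
  have hs := ZLattice.summable_norm_rpow L (-(2 * σ)) (by
    rw [ZLattice.rank ℝ L, Module.finrank_fin_fun]; linarith)
  have hinj : Function.Injective fun k : Fin d → ℤ => (⟨fun j => (k j : ℝ), hL k⟩ : L) := by
    intro k l h
    funext j
    exact Int.cast_injective (α := ℝ) (congrFun (congrArg Subtype.val h) j)
  refine Summable.of_norm_bounded_eventually (hs.comp_injective hinj) ?_
  -- The origin is excluded: there the term is `1`, while `0^(-2σ)` evaluates to `0`.
  filter_upwards [(Set.finite_singleton (0 : Fin d → ℤ)).compl_mem_cofinite] with k hk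
  have hk0 : (fun j => (k j : ℝ)) ≠ 0 := fun h => hk (by
    funext j
    exact Int.cast_injective (α := ℝ) ((congrFun h j).trans Int.cast_zero.symm))
  have h1 : ‖fun j => (k j : ℝ)‖ ^ 2 ≤ 1 + ∑ j, (k j : ℝ) ^ 2 := by
    have h2 : ‖fun j => (k j : ℝ)‖ ≤ √(∑ j, (k j : ℝ) ^ 2) := by
      refine (pi_norm_le_iff_of_nonneg (Real.sqrt_nonneg _)).2 fun i => ?_
      refine Real.le_sqrt_of_sq_le ?_
      rw [Real.norm_eq_abs, sq_abs]
      exact Finset.single_le_sum (f := fun j => (k j : ℝ) ^ 2) (fun j _ => sq_nonneg _)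
        (Finset.mem_univ i)
    have h3 := pow_le_pow_left₀ (norm_nonneg _) h2 2
    rw [Real.sq_sqrt (by positivity)] at h3
    linarith
  have hpos : 0 < ‖fun j => (k j : ℝ)‖ := norm_pos_iff.2 hk0
  rw [Real.norm_of_nonneg (by positivity)]
  change _ ≤ ‖fun j => (k j : ℝ)‖ ^ (-(2 * σ))
  calc _ ≤ (‖fun j => (k j : ℝ)‖ ^ 2) ^ (-σ) :=
        Real.rpow_le_rpow_of_nonpos (by positivity) h1 (by linarith)
    _ = _ := by
        rw [← Real.rpow_natCast, ← Real.rpow_mul hpos.le]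
        congr 1
        push_cast
        ring

/-- Integrability for the counting measure is absolute summability of the coefficients, so the
Fourier series converges uniformly to a continuous `g`. Its `L²` sum is `p`, whence `p = g` almost
everywhere, and evaluation at a point gives the series. -/
theorem torus_ae_eq_integral (d : ℕ) (p : Lp ℂ 2 (torus d).μ)
    (hp : Integrable ((torus d).hat p) (torus d).ν) :
    p =ᵐ[(torus d).μ] fun x => ∫ k, (torus d).hat p k *
      UnitAddTorus.mFourier (show Fin d → ℤ from k) x ∂(torus d).ν := by
  have h1 : Summable fun k : Fin d → ℤ => ‖UnitAddTorus.mFourierCoeff p k‖ := by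
    have h := integrable_count_iff.1
      (show Integrable (fun k : Fin d → ℤ => (torus d).hat p k) Measure.count from hp)
    exact h.congr fun k => by rw [torus_hat_apply]
  have h2 : Summable fun k : Fin d → ℤ =>
      UnitAddTorus.mFourierCoeff p k • (UnitAddTorus.mFourier k) :=
    Summable.of_norm (h1.congr fun k => by rw [norm_smul, UnitAddTorus.mFourier_norm, mul_one])
  obtain ⟨g, hg⟩ := h2
  have h3 : p = ContinuousMap.toLp (E := ℂ) 2
      (Measure.pi fun _ => AddCircle.haarAddCircle : Measure (UnitAddTorus (Fin d))) ℂ g := by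
    refine (UnitAddTorus.hasSum_mFourier_series_L2 p).unique ?_
    have h := hg.mapL (ContinuousMap.toLp (E := ℂ) 2
      (Measure.pi fun _ => AddCircle.haarAddCircle : Measure (UnitAddTorus (Fin d))) ℂ)
    simp only [map_smul] at h
    exact h
  have h4 := ContinuousMap.coeFn_toLp (p := 2) (𝕜 := ℂ)
    (Measure.pi fun _ => AddCircle.haarAddCircle : Measure (UnitAddTorus (Fin d))) g
  rw [← h3] at h4
  refine Filter.EventuallyEq.trans h4 (Filter.Eventually.of_forall fun x => ?_)
  have h5 : HasSum (fun k : Fin d → ℤ => UnitAddTorus.mFourierCoeff p k *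
      UnitAddTorus.mFourier k x) (g x) := by
    have h := hg.mapL (ContinuousMap.evalCLM ℂ (show UnitAddTorus (Fin d) from x))
    simp only [map_smul] at h
    exact h
  have h6 : Integrable (fun k : Fin d → ℤ => UnitAddTorus.mFourierCoeff p k *
      UnitAddTorus.mFourier k x) Measure.count := by
    rw [integrable_count_iff]
    refine Summable.of_nonneg_of_le (fun _ => norm_nonneg _) (fun k => ?_) h1
    rw [norm_mul]
    refine mul_le_of_le_one_right (norm_nonneg _) ?_
    exact (ContinuousMap.norm_coe_le_norm _ _).trans UnitAddTorus.mFourier_norm.le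
  have h7 := integral_countable h6
  simp only [Measure.real, Measure.count_singleton, ENNReal.toReal_one, one_smul] at h7
  rw [h5.tsum_eq] at h7
  refine h7.symm.trans (integral_congr_ae (Filter.Eventually.of_forall fun k => ?_))
  simp only [torus_hat_apply]

theorem torus_exists_isProduct (d : ℕ) {σ : ℝ} (hσ : (d : ℝ) / 2 < σ) :
    ∃ K : ℝ, 0 ≤ K ∧ ∀ f g : (torus d).Sobolev σ,
      ∃ w, IsProduct f g w ∧ ‖w‖ ≤ K * ‖f‖ * ‖g‖ := by
  have hσ0 : 0 ≤ σ := le_trans (by positivity) hσ.le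
  let _ : AddCommGroup (torus d).Freq := (inferInstance : AddCommGroup (Fin d → ℤ))
  have _ : MeasurableAdd₂ (torus d).Freq := (inferInstance : MeasurableAdd₂ (Fin d → ℤ))
  have _ : MeasurableNeg (torus d).Freq := (inferInstance : MeasurableNeg (Fin d → ℤ))
  have _ : SFinite (torus d).ν := (inferInstance : SFinite (Measure.count : Measure (Fin d → ℤ)))
  have _ : (torus d).ν.IsAddLeftInvariant :=
    (inferInstance : (Measure.count : Measure (Fin d → ℤ)).IsAddLeftInvariant)
  have _ : (torus d).ν.IsNegInvariant :=
    (inferInstance : (Measure.count : Measure (Fin d → ℤ)).IsNegInvariant)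
  refine Sobolev.exists_isProduct_of_characters hσ0 (torus_hat_surjective d)
    (fun (k : Fin d → ℤ) x => UnitAddTorus.mFourier k x) ?_ ?_ ?_ (torus_ae_eq_integral d) ?_
    (4 ^ (σ / 2)) ?_
  · exact fun x => measurable_of_countable (α := Fin d → ℤ) _
  · exact fun k l x => UnitAddTorus.mFourier_add
  · intro k x
    change ‖∏ i, fourier (k i) (x i)‖ = 1
    rw [norm_prod]
    exact Finset.prod_eq_one fun i _ => Circle.norm_coe _
  · change MemLp (fun k : Fin d → ℤ => (1 + ∑ j, (k j : ℝ) ^ 2) ^ (-σ / 2)) 2 Measure.count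
    rw [memLp_two_iff_integrable_sq (measurable_of_countable _).aestronglyMeasurable,
      integrable_count_iff]
    refine (summable_one_add_sum_sq_rpow d hσ).congr fun k => ?_
    rw [Real.norm_of_nonneg (by positivity), ← Real.rpow_natCast (_ ^ (-σ / 2)),
      ← Real.rpow_mul (by positivity)]
    congr 1
    push_cast
    ring
  · intro (k : Fin d → ℤ) (l : Fin d → ℤ)
    refine weight_add_le hσ0 ((torus d).sqFreq_nonneg _) ((torus d).sqFreq_nonneg _)
      ((torus d).sqFreq_nonneg _) ?_
    change ∑ j, (((k + l) j : ℤ) : ℝ) ^ 2 ≤ 2 * ∑ j, (k j : ℝ) ^ 2 + 2 * ∑ j, (l j : ℝ) ^ 2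
    rw [Finset.mul_sum, Finset.mul_sum, ← Finset.sum_add_distrib]
    refine Finset.sum_le_sum fun j _ => ?_
    push_cast [Pi.add_apply]
    nlinarith [sq_nonneg ((k j : ℝ) - l j)]

end FourierDomain

end

/-! ### Completeness of `H^σ` and calculus of Fourier multipliers -/

namespace FourierDomain

variable {Ω : FourierDomain} {σ : ℝ}

/-- The isometry `toWeightedL2` is onto: `F` is reached from the profile obtained by dividing `F` by
the weight. -/
theorem Sobolev.completeSpace (hσ : 0 ≤ σ) (hsurj : ∀ F : Lp ℂ 2 Ω.ν, ∃ p, Ω.hat p = F) :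
    CompleteSpace (Ω.Sobolev σ) := by
  have hiso : Isometry (toWeightedL2 (Ω := Ω) (σ := σ)) :=
    AddMonoidHomClass.isometry_of_norm _ fun f => rfl
  refine (hiso.isUniformInducing.completeSpace_congr fun F => ?_).2 inferInstance
  have hm : Measurable fun ξ => (((1 + Ω.sqFreq ξ) ^ (-(σ / 2)) : ℝ) : ℂ) :=
    Complex.measurable_ofReal.comp ((Ω.sqFreq_measurable.const_add 1).pow_const _)
  have h1 : (AEEqFun.mk _ hm.aestronglyMeasurable * (F : Ω.Freq →ₘ[Ω.ν] ℂ) : Ω.Freq →ₘ[Ω.ν] ℂ)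
      =ᵐ[Ω.ν] fun ξ => (((1 + Ω.sqFreq ξ) ^ (-(σ / 2)) : ℝ) : ℂ) * F ξ := by
    filter_upwards [AEEqFun.coeFn_mul (AEEqFun.mk _ hm.aestronglyMeasurable)
      (F : Ω.Freq →ₘ[Ω.ν] ℂ), AEEqFun.coeFn_mk _ hm.aestronglyMeasurable (μ := Ω.ν)]
      with ξ h1 h2
    rw [h1, Pi.mul_apply, h2]
  have h2 : ∀ ξ, (((1 + Ω.sqFreq ξ) ^ (σ / 2) : ℝ) : ℂ) *
      ((((1 + Ω.sqFreq ξ) ^ (-(σ / 2)) : ℝ) : ℂ) * F ξ) = F ξ := fun ξ => by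
    have h0 : 0 < 1 + Ω.sqFreq ξ := by linarith [Ω.sqFreq_nonneg ξ]
    rw [← mul_assoc, ← Complex.ofReal_mul, ← Real.rpow_add h0]
    simp
  obtain ⟨f, hf⟩ := exists_hat_eq (σ := σ) hσ hsurj
    (AEEqFun.mk _ hm.aestronglyMeasurable * (F : Ω.Freq →ₘ[Ω.ν] ℂ)) <|
    (Lp.memLp F).ae_eq (by filter_upwards [h1] with ξ hξ; rw [hξ, h2])
  refine ⟨f, Lp.ext ?_⟩
  filter_upwards [toWeightedL2_coeFn f, h1] with ξ h3 h4
  rw [h3, hf, h4, h2]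

theorem multiplier_coeFn (m : Ω.Freq → ℂ) (hm : Measurable m) (F : Ω.Freq →ₘ[Ω.ν] ℂ) :
    Ω.multiplier m hm F =ᵐ[Ω.ν] fun ξ => m ξ * F ξ := by
  filter_upwards [AEEqFun.coeFn_mul (AEEqFun.mk m hm.aestronglyMeasurable) F,
    AEEqFun.coeFn_mk _ hm.aestronglyMeasurable (μ := Ω.ν)] with ξ h1 h2
  exact h1.trans (by rw [Pi.mul_apply, h2])

theorem multiplier_multiplier {m n : Ω.Freq → ℂ} (hm : Measurable m) (hn : Measurable n)
    (F : Ω.Freq →ₘ[Ω.ν] ℂ) :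
    Ω.multiplier m hm (Ω.multiplier n hn F) =
      Ω.multiplier (fun ξ => m ξ * n ξ) (hm.mul hn) F := by
  apply AEEqFun.ext
  filter_upwards [multiplier_coeFn m hm (Ω.multiplier n hn F), multiplier_coeFn n hn F,
    multiplier_coeFn (fun ξ => m ξ * n ξ) (hm.mul hn) F] with ξ h1 h2 h3
  rw [h1, h2, h3, mul_assoc]

theorem multiplier_add {m n : Ω.Freq → ℂ} (hm : Measurable m) (hn : Measurable n)
    (F : Ω.Freq →ₘ[Ω.ν] ℂ) :
    Ω.multiplier m hm F + Ω.multiplier n hn F =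
      Ω.multiplier (fun ξ => m ξ + n ξ) (hm.add hn) F := by
  apply AEEqFun.ext
  filter_upwards [AEEqFun.coeFn_add (Ω.multiplier m hm F) (Ω.multiplier n hn F),
    multiplier_coeFn m hm F, multiplier_coeFn n hn F, multiplier_coeFn (fun ξ => m ξ + n ξ) (hm.add hn) F]
    with ξ h1 h2 h3 h4
  rw [h1, Pi.add_apply, h2, h3, h4, add_mul]

theorem multiplier_const (c : ℂ) (F : Ω.Freq →ₘ[Ω.ν] ℂ) :
    Ω.multiplier (fun _ => c) measurable_const F = c • F := by
  apply AEEqFun.ext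
  filter_upwards [multiplier_coeFn _ measurable_const F, AEEqFun.coeFn_smul c F] with ξ h1 h2
  rw [h1, h2, Pi.smul_apply, smul_eq_mul]

theorem zero_smul_aeeqFun (F : Ω.Freq →ₘ[Ω.ν] ℂ) : (0 : ℂ) • F = 0 := zero_smul ℂ F

theorem neg_smul_aeeqFun (c : ℂ) (F : Ω.Freq →ₘ[Ω.ν] ℂ) : (-c) • F = -(c • F) := neg_smul c F

theorem multiplier_sum {ι : Type*} (t : Finset ι) {m : ι → Ω.Freq → ℂ}
    (hm : ∀ i, Measurable (m i)) (F : Ω.Freq →ₘ[Ω.ν] ℂ) :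
    ∑ i ∈ t, Ω.multiplier (m i) (hm i) F =
      Ω.multiplier (fun ξ => ∑ i ∈ t, m i ξ) (Finset.measurable_fun_sum t fun i _ => hm i) F := by
  classical
  induction t using Finset.induction_on with
  | empty => exact ((multiplier_const 0 F).trans (zero_smul_aeeqFun F)).symm
  | insert a t ha ih => simp only [Finset.sum_insert ha, ih, multiplier_add]

theorem multiplier_congr {m n : Ω.Freq → ℂ} (hm : Measurable m) (hn : Measurable n)
    (h : ∀ ξ, m ξ = n ξ) (F : Ω.Freq →ₘ[Ω.ν] ℂ) : Ω.multiplier m hm F = Ω.multiplier n hn F := by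
  obtain rfl : m = n := funext h
  rfl

/-- Multipliers act on all classes of measurable functions, so unbounded symbols such as that of `L`
compose without domain questions, and a matrix identity at each frequency lifts to the operators. -/
theorem multiplier_vecMul {ι κ : Type*} [Fintype ι] [Fintype κ] {a : ι → Ω.Freq → ℂ}
    (ha : ∀ i, Measurable (a i)) {B : ι → κ → Ω.Freq → ℂ} (hB : ∀ i k, Measurable (B i k))
    {e : κ → Ω.Freq → ℂ} (he : ∀ k, Measurable (e k)) (h : ∀ ξ k, ∑ i, a i ξ * B i k ξ = e k ξ)
    (F : κ → Ω.Freq →ₘ[Ω.ν] ℂ) :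
    ∑ i, Ω.multiplier (a i) (ha i) (∑ k, Ω.multiplier (B i k) (hB i k) (F k)) =
      ∑ k, Ω.multiplier (e k) (he k) (F k) := by
  simp only [map_sum, multiplier_multiplier]
  rw [Finset.sum_comm]
  refine Finset.sum_congr rfl fun k _ => ?_
  rw [multiplier_sum]
  exact multiplier_congr _ _ (fun ξ => h ξ k) _

theorem multiplier_matrix_inv {ι : Type*} [Fintype ι] [DecidableEq ι]
    {A B : Ω.Freq → Matrix ι ι ℂ} (hA : ∀ i j, Measurable fun ξ => A ξ i j)
    (hB : ∀ i j, Measurable fun ξ => B ξ i j) (h : ∀ ξ, A ξ * B ξ = 1)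
    (F : ι → Ω.Freq →ₘ[Ω.ν] ℂ) (i : ι) :
    ∑ j, Ω.multiplier _ (hA i j) (∑ k, Ω.multiplier _ (hB j k) (F k)) = F i := by
  rw [multiplier_vecMul (e := fun k _ => (1 : Matrix ι ι ℂ) i k) _ _ (fun k => measurable_const)
    (fun ξ k => by rw [← h ξ, Matrix.mul_apply])]
  simp only [multiplier_const]
  rw [Finset.sum_eq_single i (fun k _ hk => by
    rw [Matrix.one_apply_ne hk.symm, zero_smul_aeeqFun]) (fun h => (h (Finset.mem_univ i)).elim),
    Matrix.one_apply_eq, one_smul]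

/-- Bounded Fourier multipliers act on `H^σ`. -/
theorem Sobolev.exists_multiplier (hσ : 0 ≤ σ) (hsurj : ∀ F : Lp ℂ 2 Ω.ν, ∃ p, Ω.hat p = F)
    (m : Ω.Freq → ℂ) (hm : Measurable m) {K : ℝ} (hK0 : 0 ≤ K)
    (hK : ∀ ξ, ‖m ξ‖ ≤ K) :
    ∃ P : Ω.Sobolev σ →ₗ[ℂ] Ω.Sobolev σ,
      (∀ f, hat (P f) = Ω.multiplier m hm (hat f)) ∧ ∀ f, ‖P f‖ ≤ K * ‖f‖ := by
  have hle : ∀ (f : Ω.Sobolev σ) ξ, ‖(((1 + Ω.sqFreq ξ) ^ (σ / 2) : ℝ) : ℂ) * (m ξ * hat f ξ)‖ ≤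
      K * ‖(((1 + Ω.sqFreq ξ) ^ (σ / 2) : ℝ) : ℂ) * hat f ξ‖ := fun f ξ => by
    rw [mul_left_comm, norm_mul]
    exact mul_le_mul_of_nonneg_right (hK ξ) (norm_nonneg _)
  have hmeas : ∀ f : Ω.Sobolev σ, AEStronglyMeasurable
      (fun ξ => (((1 + Ω.sqFreq ξ) ^ (σ / 2) : ℝ) : ℂ) * (m ξ * hat f ξ)) Ω.ν := fun f =>
    ((Complex.measurable_ofReal.comp (measurable_weight σ)).mul
      (hm.mul (hat f).stronglyMeasurable.measurable)).aestronglyMeasurable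
  have hex : ∀ f : Ω.Sobolev σ, ∃ g : Ω.Sobolev σ, hat g = Ω.multiplier m hm (hat f) := fun f => by
    refine exists_hat_eq hσ hsurj _ (MemLp.ae_eq ?_
      ((memLp_weight_mul_hat f).of_le_mul (hmeas f) (Filter.Eventually.of_forall (hle f))))
    filter_upwards [multiplier_coeFn m hm (hat f)] with ξ hξ
    rw [hξ]
  choose P hP using hex
  refine ⟨{ toFun := P, map_add' := fun f g => ?_, map_smul' := fun c f => ?_ }, hP, fun f => ?_⟩
  · apply Sobolev.hat_injective
    rw [map_add, hP, hP, hP, map_add, map_add]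
  · apply Sobolev.hat_injective
    rw [map_smul, hP, hP, map_smul, RingHom.id_apply, map_smul]
  · change ‖P f‖ ≤ _
    rw [norm_eq_eLpNorm (P f)]
    refine ENNReal.toReal_le_of_le_ofReal (by positivity) ?_
    rw [ENNReal.ofReal_mul hK0, ← eLpNorm_weight_mul_hat f, hP]
    refine eLpNorm_le_mul_eLpNorm_of_ae_le_mul ?_ 2
    filter_upwards [multiplier_coeFn m hm (hat f)] with ξ hξ
    rw [hξ]
    exact hle f ξ

end FourierDomain

/-! ### Measurability of the Runge–Kutta symbols -/

namespace RungeKutta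

variable {s : ℕ} (rk : RungeKutta s)

theorem measurable_resolventMatrix (i j : Fin s) : Measurable fun z => rk.resolventMatrix z i j := by
  simp only [resolventMatrix, Matrix.sub_apply, Matrix.smul_apply, smul_eq_mul]
  fun_prop

theorem continuous_resolventMatrix : Continuous rk.resolventMatrix := by
  unfold resolventMatrix
  fun_prop

theorem measurable_resolventMatrix_inv (i j : Fin s) :
    Measurable fun z => (rk.resolventMatrix z)⁻¹ i j := by
  simp only [Matrix.inv_def, Matrix.smul_apply, Ring.inverse_eq_inv', smul_eq_mul]
  have h1 : Continuous fun z => (rk.resolventMatrix z).det := rk.continuous_resolventMatrix.matrix_det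
  have h2 : Continuous fun z => (rk.resolventMatrix z).adjugate i j :=
    (rk.continuous_resolventMatrix.matrix_adjugate).matrix_elem i j
  exact h1.measurable.inv.mul h2.measurable

theorem measurable_stabRow (j : Fin s) : Measurable fun z => rk.stabRow z j := by
  simp only [stabRow, Pi.smul_apply, smul_eq_mul, Matrix.vecMul, dotProduct]
  refine measurable_id.mul (Finset.measurable_fun_sum _ fun i _ => ?_)
  exact (rk.measurable_resolventMatrix_inv i j).const_mul _

theorem measurable_stabFun : Measurable rk.stabFun := by
  unfold stabFun
  simp only [dotProduct, Pi.one_apply, mul_one]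
  exact (Finset.measurable_fun_sum _ fun i _ => rk.measurable_stabRow i).const_add _

end RungeKutta

/-! ### The stage equations as bounded operators on `H^σ` -/

section Stages

open RungeKutta

variable {Ω : FourierDomain} {σ : ℝ} {s : ℕ}

/-- The symbol `hλ(ξ)` of `hL`. -/
noncomputable def LinearPart.scaledSymbol (L : LinearPart) (Ω : FourierDomain) (h : ℝ) (ξ : Ω.Freq) :
    ℂ :=
  (h : ℂ) * (L.factor * (Ω.lap ξ : ℂ))

theorem LinearPart.measurable_scaledSymbol (L : LinearPart) (h : ℝ) :
    Measurable (L.scaledSymbol Ω h) :=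
  ((Complex.measurable_ofReal.comp Ω.lap_measurable).const_mul _).const_mul _

theorem LinearPart.multiplier_scaledSymbol (L : LinearPart) (h : ℝ) (f : Ω.Sobolev σ) :
    Ω.multiplier (L.scaledSymbol Ω h) (L.measurable_scaledSymbol h) (hat f) =
      (h : ℂ) • L.applyHat f := by
  rw [← multiplier_const]
  exact (multiplier_multiplier measurable_const _ _).symm

/-- `Σⱼ (δᵢⱼ - hλaᵢⱼ) f̂ⱼ = f̂ᵢ - h Σⱼ aᵢⱼ L̂fⱼ`. -/
theorem sum_multiplier_resolventMatrix (rk : RungeKutta s) (L : LinearPart) (h : ℝ)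
    (U : Fin s → Ω.Sobolev σ) (i : Fin s) :
    ∑ j, Ω.multiplier (fun ξ => rk.resolventMatrix (L.scaledSymbol Ω h ξ) i j)
      ((rk.measurable_resolventMatrix i j).comp (L.measurable_scaledSymbol h)) (hat (U j)) =
      hat (U i) - (h : ℂ) • ∑ j, (rk.A i j : ℂ) • L.applyHat (U j) := by
  have h1 : ∀ j, Ω.multiplier (fun ξ => rk.resolventMatrix (L.scaledSymbol Ω h ξ) i j)
      ((rk.measurable_resolventMatrix i j).comp (L.measurable_scaledSymbol h)) (hat (U j)) =
      (1 : Matrix (Fin s) (Fin s) ℂ) i j • hat (U j) -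
        (h : ℂ) • (rk.A i j : ℂ) • L.applyHat (U j) := by
    intro j
    have h2 := multiplier_add (Ω := Ω) (m := fun _ => (1 : Matrix (Fin s) (Fin s) ℂ) i j)
      (n := fun ξ => -(rk.A i j : ℂ) * L.scaledSymbol Ω h ξ) measurable_const
      ((L.measurable_scaledSymbol h).const_mul _) (hat (U j))
    rw [multiplier_const] at h2
    rw [multiplier_congr _ (measurable_const.add ((L.measurable_scaledSymbol h).const_mul _))
      (n := fun ξ => (1 : Matrix (Fin s) (Fin s) ℂ) i j +
        -(rk.A i j : ℂ) * L.scaledSymbol Ω h ξ), ← h2,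
      ← multiplier_multiplier measurable_const (L.measurable_scaledSymbol h), multiplier_const,
      L.multiplier_scaledSymbol, neg_smul_aeeqFun, ← sub_eq_add_neg, smul_comm]
    intro ξ
    simp only [resolventMatrix, Matrix.sub_apply, Matrix.smul_apply, Matrix.map_apply, smul_eq_mul]
    ring
  simp only [h1, Finset.sum_sub_distrib, Finset.smul_sum]
  congr 1
  rw [Finset.sum_eq_single i (fun k _ hk => by
    rw [Matrix.one_apply_ne hk.symm, zero_smul_aeeqFun]) (fun h => (h (Finset.mem_univ i)).elim),
    Matrix.one_apply_eq, one_smul]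

/-- The stage equations, perturbed by `ρ`. -/
def IsPerturbedStage (rk : RungeKutta s) (L : LinearPart) (h : ℝ) (v : Ω.Sobolev σ)
    (U G ρ : Fin s → Ω.Sobolev σ) : Prop :=
  ∀ i, hat (U i) =
    hat v + (h : ℂ) • ∑ j, (rk.A i j : ℂ) • (L.applyHat (U j) + hat (G j)) + hat (ρ i)

/-- The update, perturbed by `τ`. -/
def IsPerturbedUpdate (rk : RungeKutta s) (L : LinearPart) (h : ℝ) (v : Ω.Sobolev σ)
    (U G : Fin s → Ω.Sobolev σ) (v' τ : Ω.Sobolev σ) : Prop :=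
  hat v' = hat v + (h : ℂ) • ∑ i, (rk.b i : ℂ) • (L.applyHat (U i) + hat (G i)) + hat τ

/-- The stage equations and the update in terms of bounded operators on `H^σ`. -/
theorem exists_stage_operators (hσ : 0 ≤ σ) (hsurj : ∀ F : Lp ℂ 2 Ω.ν, ∃ p, Ω.hat p = F)
    (rk : RungeKutta s) (L : LinearPart) {S : Set ℂ} (hst : rk.StableOn S)
    (hrow : rk.RowStableOn S) (hinv : rk.InvStableOn S) :
    ∃ K : ℝ, 0 ≤ K ∧ ∀ h : ℝ, (∀ ξ, L.scaledSymbol Ω h ξ ∈ S) →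
      ∃ (P : Fin s → Fin s → Ω.Sobolev σ →ₗ[ℂ] Ω.Sobolev σ)
        (Q : Fin s → Ω.Sobolev σ →ₗ[ℂ] Ω.Sobolev σ) (R : Ω.Sobolev σ →ₗ[ℂ] Ω.Sobolev σ),
        (∀ i j f, ‖P i j f‖ ≤ K * ‖f‖) ∧ (∀ j f, ‖Q j f‖ ≤ K * ‖f‖) ∧ (∀ f, ‖R f‖ ≤ ‖f‖) ∧
        (∀ v U G ρ, IsPerturbedStage rk L h v U G ρ ↔
          ∀ i, U i = ∑ j, P i j (v + ((h : ℂ) • ∑ k, (rk.A j k : ℂ) • G k + ρ j))) ∧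
        ∀ v U G ρ v' τ, IsPerturbedStage rk L h v U G ρ →
          (IsPerturbedUpdate rk L h v U G v' τ ↔
            v' = R v + ∑ j, Q j ((h : ℂ) • ∑ k, (rk.A j k : ℂ) • G k + ρ j) +
              (h : ℂ) • ∑ i, (rk.b i : ℂ) • G i + τ) := by
  obtain ⟨hunit, K₁, hK₁⟩ := hrow
  obtain ⟨-, K₂, hK₂⟩ := hinv
  -- The constant comes from the uniform bounds on `S` alone and is therefore independent of `h`.
  refine ⟨max 0 (max K₁ K₂), le_max_left _ _, fun h hS => ?_⟩
  set Z := L.scaledSymbol Ω h with hZ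
  have hZm : Measurable Z := L.measurable_scaledSymbol h
  have mP : ∀ i j, Measurable fun ξ => (rk.resolventMatrix (Z ξ))⁻¹ i j := fun i j =>
    (rk.measurable_resolventMatrix_inv i j).comp hZm
  have mQ : ∀ j, Measurable fun ξ => rk.stabRow (Z ξ) j := fun j =>
    (rk.measurable_stabRow j).comp hZm
  have mM : ∀ i j, Measurable fun ξ => rk.resolventMatrix (Z ξ) i j := fun i j =>
    (rk.measurable_resolventMatrix i j).comp hZm
  have mR : Measurable fun ξ => rk.stabFun (Z ξ) := rk.measurable_stabFun.comp hZm
  choose P hP hPb using fun i j => Sobolev.exists_multiplier hσ hsurj _ (mP i j)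
    (le_max_left 0 (max K₁ K₂)) fun ξ => (hK₂ (Z ξ) (hS ξ) i j).trans
      ((le_max_right _ _).trans (le_max_right _ _))
  choose Q hQ hQb using fun j => Sobolev.exists_multiplier hσ hsurj _ (mQ j)
    (le_max_left 0 (max K₁ K₂)) fun ξ => (hK₁ (Z ξ) (hS ξ) j).trans
      ((le_max_left _ _).trans (le_max_right _ _))
  -- The bound here has to be exactly `1`, as `R` is iterated about `T/h` times.
  obtain ⟨R, hR, hRb⟩ := Sobolev.exists_multiplier (σ := σ) hσ hsurj _ mR zero_le_one
    fun ξ => hst (Z ξ) (hS ξ)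
  have hdet : ∀ ξ, IsUnit (rk.resolventMatrix (Z ξ)).det := fun ξ =>
    (Matrix.isUnit_iff_isUnit_det _).1 (hunit _ (hS ξ))
  have hstage : ∀ v U G ρ, IsPerturbedStage rk L h v U G ρ ↔
      ∀ i, U i = ∑ j, P i j (v + ((h : ℂ) • ∑ k, (rk.A j k : ℂ) • G k + ρ j)) := by
    intro v U G ρ
    have e1 : IsPerturbedStage rk L h v U G ρ ↔ ∀ i, ∑ j, Ω.multiplier _ (mM i j) (hat (U j)) =
        hat (v + ((h : ℂ) • ∑ k, (rk.A i k : ℂ) • G k + ρ i)) := by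
      refine forall_congr' fun i => ?_
      rw [sum_multiplier_resolventMatrix, sub_eq_iff_eq_add]
      simp only [map_add, map_smul, map_sum, smul_add, Finset.sum_add_distrib]
      constructor <;> intro h <;> rw [h] <;> abel
    rw [e1]
    constructor
    · intro H i
      apply Sobolev.hat_injective
      rw [map_sum]
      simp only [hP, ← H]
      exact (multiplier_matrix_inv mP mM (fun ξ => Matrix.nonsing_inv_mul _ (hdet ξ))
        (fun j => hat (U j)) i).symm
    · intro H i
      have e2 : ∀ j, hat (U j) = ∑ k, Ω.multiplier _ (mP j k)
          (hat (v + ((h : ℂ) • ∑ l, (rk.A k l : ℂ) • G l + ρ k))) := fun j => by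
        rw [H j, map_sum]
        simp only [hP]
      simp only [e2]
      exact multiplier_matrix_inv mM mP (fun ξ => Matrix.mul_nonsing_inv _ (hdet ξ))
        (fun k => hat (v + ((h : ℂ) • ∑ l, (rk.A k l : ℂ) • G l + ρ k))) i
  refine ⟨P, Q, R, hPb, hQb, fun f => by simpa using hRb f, hstage, ?_⟩
  intro v U G ρ v' τ hU
  rw [hstage] at hU
  set y : Fin s → Ω.Sobolev σ := fun j => (h : ℂ) • ∑ k, (rk.A j k : ℂ) • G k + ρ j with hy
  have e2 : ∀ j, hat (U j) = ∑ k, Ω.multiplier _ (mP j k) (hat (v + y k)) := fun j => by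
    rw [hU j, map_sum]
    simp only [hP, hy]
  -- The symbol `Z bᵗ` alone may be unbounded. Applied to stages of the form `(I - ZA)⁻¹(v + y)` it
  -- becomes the bounded row `Z bᵗ(I - ZA)⁻¹`.
  have e3 : (h : ℂ) • ∑ i, (rk.b i : ℂ) • L.applyHat (U i) =
      ∑ k, Ω.multiplier _ (mQ k) (hat (v + y k)) := by
    rw [Finset.smul_sum, ← multiplier_vecMul (a := fun i ξ => (rk.b i : ℂ) * Z ξ)
      (fun i => hZm.const_mul _) mP mQ]
    · refine Finset.sum_congr rfl fun i _ => ?_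
      rw [← e2, ← multiplier_multiplier measurable_const hZm, multiplier_const, smul_comm,
        L.multiplier_scaledSymbol]
    · intro ξ k
      simp only [stabRow, Pi.smul_apply, Matrix.vecMul, dotProduct, smul_eq_mul, Finset.mul_sum]
      exact Finset.sum_congr rfl fun i _ => by ring
  -- The `v` part of `e3` joins the leading `v` of the update to form `R v`; only the `y` part is
  -- left to `Q`.
  have e4 : hat (R v) = hat v + ∑ k, Ω.multiplier _ (mQ k) (hat v) := by
    rw [hR, multiplier_sum, ← one_smul ℂ (hat v), ← multiplier_const 1, multiplier_multiplier,
      multiplier_multiplier, multiplier_add]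
    refine multiplier_congr _ _ (fun ξ => ?_) _
    simp [stabFun, dotProduct]
  have e5 : hat (R v + ∑ j, Q j (y j) + (h : ℂ) • ∑ i, (rk.b i : ℂ) • G i + τ) =
      hat v + (h : ℂ) • ∑ i, (rk.b i : ℂ) • (L.applyHat (U i) + hat (G i)) + hat τ := by
    simp only [smul_add, Finset.sum_add_distrib, e3]
    simp only [map_add, e4, map_sum, hQ, map_smul, Finset.sum_add_distrib]
    abel
  rw [IsPerturbedUpdate, ← e5]
  exact Sobolev.hat_injective.eq_iff

end Stages

/-! ### Products and elementary norm bounds -/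

section Products

variable {Ω : FourierDomain} {σ : ℝ}

theorem FourierDomain.Sobolev.ext_ae {f g : Ω.Sobolev σ} (h : toL2 f =ᵐ[Ω.μ] toL2 g) : f = g :=
  Subtype.ext (Lp.ext h)

/-- The splitting `νw - γU = γ(w - U) + (ν - γ)w`. It is arranged so that only the numerical `γ` and
the exact `w` need a priori bounds, and none is needed for the numerical stage `U`. -/
theorem norm_sub_le_of_isProduct {K : ℝ}
    (hK : ∀ f g : Ω.Sobolev σ, ∃ w, IsProduct f g w ∧ ‖w‖ ≤ K * ‖f‖ * ‖g‖)
    {ν w g γ U G : Ω.Sobolev σ} (h₁ : IsProduct ν w g) (h₂ : IsProduct γ U G) :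
    ‖g - G‖ ≤ K * ‖γ‖ * ‖w - U‖ + K * ‖ν - γ‖ * ‖w‖ := by
  obtain ⟨a, ha, ha'⟩ := hK γ (w - U)
  obtain ⟨b, hb, hb'⟩ := hK (ν - γ) w
  have : g - G = a + b := by
    apply ext_ae
    rw [map_sub, map_add]
    rw [IsProduct, map_sub] at ha hb
    filter_upwards [h₁, h₂, ha, hb, Lp.coeFn_sub (toL2 g) (toL2 G), Lp.coeFn_add (toL2 a) (toL2 b),
      Lp.coeFn_sub (toL2 w) (toL2 U), Lp.coeFn_sub (toL2 ν) (toL2 γ)]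
      with x h1 h2 h3 h4 h5 h6 h7 h8
    rw [h5, h6, Pi.sub_apply, Pi.add_apply, h1, h2, h3, h4, h7, h8, Pi.sub_apply, Pi.sub_apply]
    ring
  rw [this]
  exact (norm_add_le _ _).trans (add_le_add ha' hb')

theorem FourierDomain.Sobolev.IsProduct.unique {f g w w' : Ω.Sobolev σ} (h : IsProduct f g w)
    (h' : IsProduct f g w') : w = w' :=
  ext_ae (h.trans h'.symm)

end Products

theorem norm_sum_smul_le {E ι : Type*} [NormedAddCommGroup E] [NormedSpace ℂ E] [Fintype ι]
    {a : ι → ℝ} {x : ι → E} {α X : ℝ} (hα : 0 ≤ α) (ha : ∀ i, |a i| ≤ α) (hx : ∀ i, ‖x i‖ ≤ X) :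
    ‖∑ i, (a i : ℂ) • x i‖ ≤ Fintype.card ι * α * X := by
  refine (norm_sum_le_of_le _ (n := fun _ => α * X) fun i _ => ?_).trans (by simp [mul_assoc])
  rw [norm_smul, Complex.norm_real, Real.norm_eq_abs]
  exact mul_le_mul (ha i) (hx i) (norm_nonneg _) hα

theorem norm_sum_apply_le {E ι : Type*} [NormedAddCommGroup E] [Fintype ι]
    {P : ι → E → E} {x : ι → E} {K X : ℝ} (hK : 0 ≤ K) (hP : ∀ i f, ‖P i f‖ ≤ K * ‖f‖)
    (hx : ∀ i, ‖x i‖ ≤ X) :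
    ‖∑ i, P i (x i)‖ ≤ Fintype.card ι * K * X := by
  refine (norm_sum_le_of_le _ (n := fun _ => K * X) fun i _ => ?_).trans (by simp [mul_assoc])
  exact (hP i _).trans (mul_le_mul_of_nonneg_left (hx i) hK)

theorem RungeKutta.exists_coeff_bound {s : ℕ} (rk : RungeKutta s) :
    ∃ α : ℝ, 0 ≤ α ∧ (∀ i j, |rk.A i j| ≤ α) ∧ ∀ i, |rk.b i| ≤ α := by
  obtain ⟨a, ha⟩ := (Set.finite_range fun p : Fin s × Fin s => |rk.A p.1 p.2|).bddAbove
  obtain ⟨b, hb⟩ := (Set.finite_range fun i : Fin s => |rk.b i|).bddAbove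
  exact ⟨max 0 (max a b), le_max_left _ _,
    fun i j => (ha ⟨(i, j), rfl⟩).trans ((le_max_left _ _).trans (le_max_right _ _)),
    fun i => (hb ⟨i, rfl⟩).trans ((le_max_right _ _).trans (le_max_right _ _))⟩

/-! ### One step: solvability and error propagation -/

section Step

variable {Ω : FourierDomain} {σ : ℝ} {s : ℕ}

theorem isPerturbedStage_zero_iff {rk : RungeKutta s} {L : LinearPart} {h : ℝ} {v : Ω.Sobolev σ}
    {U G : Fin s → Ω.Sobolev σ} : IsPerturbedStage rk L h v U G 0 ↔
      ∀ i, hat (U i) = hat v + (h : ℂ) • ∑ j, (rk.A i j : ℂ) • (L.applyHat (U j) + hat (G j)) := by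
  simp [IsPerturbedStage]

theorem isPerturbedUpdate_zero_iff {rk : RungeKutta s} {L : LinearPart} {h : ℝ} {v : Ω.Sobolev σ}
    {U G : Fin s → Ω.Sobolev σ} {v' : Ω.Sobolev σ} : IsPerturbedUpdate rk L h v U G v' 0 ↔
      hat v' = hat v + (h : ℂ) • ∑ i, (rk.b i : ℂ) • (L.applyHat (U i) + hat (G i)) := by
  simp [IsPerturbedUpdate]

/-- For small steps, one step of the linearly implicit method is well defined. -/
theorem exists_step (hσ : 0 ≤ σ) (hsurj : ∀ F : Lp ℂ 2 Ω.ν, ∃ p, Ω.hat p = F)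
    (hprod : ∃ K : ℝ, 0 ≤ K ∧
      ∀ f g : Ω.Sobolev σ, ∃ w, IsProduct f g w ∧ ‖w‖ ≤ K * ‖f‖ * ‖g‖)
    (rk : RungeKutta s) (L : LinearPart) {S : Set ℂ} (hst : rk.StableOn S)
    (hrow : rk.RowStableOn S) (hinv : rk.InvStableOn S) {M : ℝ} (hM : 0 ≤ M) :
    ∃ h₁ > (0 : ℝ), ∀ h ∈ Ioo 0 h₁, (∀ ξ, L.scaledSymbol Ω h ξ ∈ S) →
      ∀ (v : Ω.Sobolev σ) (γ : Fin s → Ω.Sobolev σ), (∀ i, ‖γ i‖ ≤ M) →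
        ∃ U v', IsStageSolution rk L h v γ U ∧ (∀ U', IsStageSolution rk L h v γ U' → U' = U) ∧
          IsUpdate rk L h v γ U v' := by
  obtain ⟨Kp, hKp0, hKp⟩ := hprod
  obtain ⟨K, hK0, hK⟩ := exists_stage_operators hσ hsurj rk L hst hrow hinv
  obtain ⟨α, hα0, hα, -⟩ := rk.exists_coeff_bound
  set c : ℝ := s * K * (s * α * (Kp * M)) with hc
  have hc0 : 0 ≤ c := by positivity
  -- The stage map `Φ` below has Lipschitz constant at most `hc`, which this choice makes at most
  -- `1/2`; the `+ 1` covers `c = 0`.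
  refine ⟨1 / (2 * (c + 1)), by positivity, fun h hh hS v γ hγ => ?_⟩
  obtain ⟨P, Q, R, hP, -, -, hstage, hupdate⟩ := hK h hS
  choose B hB hBn using hKp
  have := Sobolev.completeSpace hσ hsurj
  set Φ : (Fin s → Ω.Sobolev σ) → Fin s → Ω.Sobolev σ := fun U i =>
    ∑ j, P i j (v + ((h : ℂ) • ∑ k, (rk.A j k : ℂ) • B (γ k) (U k) + 0)) with hΦ
  have hch : h * c ≤ 1 / 2 := by
    have h1 := mul_le_mul_of_nonneg_right hh.2.le hc0
    refine h1.trans ?_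
    rw [div_mul_eq_mul_div, div_le_div_iff₀ (by positivity) (by positivity)]
    linarith
  have hcontr : ContractingWith (1 / 2) Φ := by
    refine ⟨by norm_num, LipschitzWith.of_dist_le_mul fun U U' => ?_⟩
    rw [dist_eq_norm, dist_eq_norm, pi_norm_le_iff_of_nonneg (by positivity)]
    intro i
    have h1 : (Φ U - Φ U') i = ∑ j, P i j ((h : ℂ) • ∑ k, (rk.A j k : ℂ) •
        (B (γ k) (U k) - B (γ k) (U' k))) := by
      simp only [hΦ, Pi.sub_apply, ← Finset.sum_sub_distrib, ← map_sub]
      simp only [smul_sub, Finset.sum_sub_distrib]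
      refine Finset.sum_congr rfl fun j _ => ?_
      congr 1
      abel
    rw [h1]
    refine (norm_sum_apply_le (X := h * (s * α * (Kp * M * ‖U - U'‖))) hK0 (hP i)
      fun j => ?_).trans ?_
    · rw [norm_smul, Complex.norm_real, Real.norm_of_nonneg hh.1.le]
      refine mul_le_mul_of_nonneg_left ?_ hh.1.le
      refine (norm_sum_smul_le hα0 (hα j) fun k => ?_).trans_eq (by rw [Fintype.card_fin])
      refine (norm_sub_le_of_isProduct (fun f g => ⟨_, hB f g, hBn f g⟩) (hB _ _)
        (hB _ _)).trans ?_
      rw [sub_self, norm_zero, mul_zero, zero_mul, add_zero]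
      have := norm_le_pi_norm (U - U') k
      rw [Pi.sub_apply] at this
      have h2 := hγ k
      gcongr
    · rw [Fintype.card_fin]
      calc _ = h * c * ‖U - U'‖ := by rw [hc]; ring
        _ ≤ 1 / 2 * ‖U - U'‖ := by gcongr
        _ = _ := by norm_num
  -- No bound is imposed on the candidate `U`, so uniqueness of the fixed point is uniqueness in all
  -- of `(H^σ)ˢ`.
  have hiff : ∀ U, IsStageSolution rk L h v γ U ↔ Φ U = U := by
    intro U
    have h2 : IsStageSolution rk L h v γ U ↔
        IsPerturbedStage rk L h v U (fun k => B (γ k) (U k)) 0 := by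
      rw [isPerturbedStage_zero_iff]
      constructor
      · rintro ⟨G, hG, h⟩
        obtain rfl : G = fun k => B (γ k) (U k) := funext fun k => (hG k).unique (hB _ _)
        exact h
      · exact fun h => ⟨_, fun k => hB _ _, h⟩
    rw [h2, hstage, funext_iff]
    exact forall_congr' fun i => eq_comm
  have hfix := hcontr.fixedPoint_isFixedPt
  set U := hcontr.fixedPoint Φ with hU
  refine ⟨U, R v + ∑ j, Q j ((h : ℂ) • ∑ k, (rk.A j k : ℂ) • B (γ k) (U k) +
    (0 : Fin s → Ω.Sobolev σ) j) + (h : ℂ) • ∑ i, (rk.b i : ℂ) • B (γ i) (U i) + 0,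
    (hiff U).2 hfix, fun U' hU' => ?_, fun k => B (γ k) (U k), fun k => hB _ _, ?_⟩
  · exact hcontr.fixedPoint_unique ((hiff U').1 hU')
  · rw [← isPerturbedUpdate_zero_iff]
    refine (hupdate v U (fun k => B (γ k) (U k)) 0 _ 0 ?_).2 rfl
    rw [hstage]
    exact fun i => (congrFun hfix i).symm

/-- Error propagation over one step of the linearly implicit method. -/
theorem exists_step_error (hσ : 0 ≤ σ) (hsurj : ∀ F : Lp ℂ 2 Ω.ν, ∃ p, Ω.hat p = F)
    (hprod : ∃ K : ℝ, 0 ≤ K ∧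
      ∀ f g : Ω.Sobolev σ, ∃ w, IsProduct f g w ∧ ‖w‖ ≤ K * ‖f‖ * ‖g‖)
    (rk : RungeKutta s) (L : LinearPart) {S : Set ℂ} (hst : rk.StableOn S)
    (hrow : rk.RowStableOn S) (hinv : rk.InvStableOn S) {M X : ℝ} (hM : 0 ≤ M) (hX : 0 ≤ X) :
    ∃ C : ℝ, 0 ≤ C ∧ ∃ h₁ > (0 : ℝ), ∀ h ∈ Ioo 0 h₁, (∀ ξ, L.scaledSymbol Ω h ξ ∈ S) →
      ∀ (v v' : Ω.Sobolev σ) (γ U : Fin s → Ω.Sobolev σ), (∀ i, ‖γ i‖ ≤ M) →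
        IsStageSolution rk L h v γ U → IsUpdate rk L h v γ U v' →
      ∀ (w w' : Ω.Sobolev σ) (ν W W' g : Fin s → Ω.Sobolev σ) (δ τ : ℝ),
        (∀ i, IsProduct (ν i) (W i) (g i)) → (∀ i, hat (W' i) = L.applyHat (W i) + hat (g i)) →
        (∀ i, ‖W i‖ ≤ X) → (∀ i, ‖ν i - γ i‖ ≤ δ) → 0 ≤ δ →
        (∀ i, ‖W i - w - (h : ℂ) • ∑ j, (rk.A i j : ℂ) • W' j‖ ≤ τ) →
        ‖w' - w - (h : ℂ) • ∑ i, (rk.b i : ℂ) • W' i‖ ≤ τ →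
        ‖w' - v'‖ ≤ (1 + C * h) * ‖w - v‖ + C * (h * δ + τ) := by
  obtain ⟨Kp, hKp0, hKp⟩ := hprod
  obtain ⟨K, hK0, hK⟩ := exists_stage_operators hσ hsurj rk L hst hrow hinv
  obtain ⟨α, hα0, hα, hβ⟩ := rk.exists_coeff_bound
  set c : ℝ := s * K * (s * α * (Kp * M)) with hc
  have hc0 : 0 ≤ c := by positivity
  -- The product differences reach the update through `Q` (first summand) and directly through `b`
  -- (second summand).
  set A : ℝ := s * K * (s * α) + s * α with hA
  have hA0 : 0 ≤ A := by positivity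
  set C₁ : ℝ := A * (Kp * M) * (2 * (s * K)) with hC₁
  have hC₁0 : 0 ≤ C₁ := by positivity
  set B₁ : ℝ := C₁ * (s * α * (Kp * X)) with hB₁
  have hB₁0 : 0 ≤ B₁ := by positivity
  set B₂ : ℝ := A * (Kp * X) with hB₂
  have hB₂0 : 0 ≤ B₂ := by positivity
  set B₃ : ℝ := s * K + 1 with hB₃
  have hB₃0 : 0 ≤ B₃ := by positivity
  -- The bound `h ≤ 1` serves to drop surplus factors `h`; the other bound gives `hc ≤ 1/2` for the
  -- absorption in `hE'`.
  refine ⟨C₁ + B₁ + B₂ + B₃, by positivity, min 1 (1 / (2 * (c + 1))), by positivity,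
    fun h hh hS v v' γ U hγ ⟨G, hG, hU⟩ ⟨G', hG', hv'⟩ w w' ν W W' g δ τ hg hW' hWX hνγ hδ
      hτ hτ' => ?_⟩
  have hh1 : h ≤ 1 := hh.2.le.trans (min_le_left _ _)
  have hh0 : 0 < h := hh.1
  have hch : h * c ≤ 1 / 2 := by
    have h1 := mul_le_mul_of_nonneg_right (hh.2.le.trans (min_le_right _ _)) hc0
    refine h1.trans ?_
    rw [div_mul_eq_mul_div, div_le_div_iff₀ (by positivity) (by positivity)]
    linarith
  obtain ⟨P, Q, R, hP, hQ, hR, hstage, hupdate⟩ := hK h hS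
  obtain rfl : G' = G := funext fun k => (hG' k).unique (hG k)
  rw [← isPerturbedStage_zero_iff] at hU
  rw [← isPerturbedUpdate_zero_iff, hupdate _ _ _ _ _ _ hU] at hv'
  rw [hstage] at hU
  set ρ : Fin s → Ω.Sobolev σ := fun i => W i - w - (h : ℂ) • ∑ j, (rk.A i j : ℂ) • W' j with hρ
  set ρ' : Ω.Sobolev σ := w' - w - (h : ℂ) • ∑ i, (rk.b i : ℂ) • W' i with hρ'
  have hW : IsPerturbedStage rk L h w W g ρ := by
    intro i
    simp only [← hW', hρ, map_sub, map_smul, map_sum]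
    abel
  have hw' : IsPerturbedUpdate rk L h w W g w' ρ' := by
    simp only [IsPerturbedUpdate, ← hW', hρ', map_sub, map_smul, map_sum]
    abel
  rw [hupdate _ _ _ _ _ _ hW] at hw'
  rw [hstage] at hW
  have hτ0 : 0 ≤ τ := (norm_nonneg _).trans hτ'
  set Y : ℝ := Kp * M * ‖W - U‖ + Kp * X * δ with hY
  have hgG : ∀ k, ‖g k - G' k‖ ≤ Y := fun k => by
    refine (norm_sub_le_of_isProduct hKp (hg k) (hG k)).trans ?_
    have h1 := norm_le_pi_norm (W - U) k
    rw [Pi.sub_apply] at h1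
    have h2 := hγ k
    have h3 := hνγ k
    have h4 := hWX k
    have h5 : Kp * X * δ = Kp * δ * X := by ring
    rw [hY, h5]
    gcongr
  have hinner : ∀ j, ‖((h : ℂ) • ∑ k, (rk.A j k : ℂ) • (g k - G' k) + ρ j)‖ ≤
      h * (s * α * Y) + τ := fun j => by
    refine (norm_add_le _ _).trans (add_le_add ?_ (hτ j))
    rw [norm_smul, Complex.norm_real, Real.norm_of_nonneg hh0.le]
    refine mul_le_mul_of_nonneg_left ?_ hh0.le
    exact (norm_sum_smul_le hα0 (hα j) hgG).trans_eq (by rw [Fintype.card_fin])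
  have hE : ‖W - U‖ ≤ s * K * (‖w - v‖ + (h * (s * α * Y) + τ)) := by
    have hY0 : 0 ≤ Y := by positivity
    rw [pi_norm_le_iff_of_nonneg (by positivity)]
    intro i
    have h1 : (W - U) i = ∑ j, P i j ((w - v) + ((h : ℂ) • ∑ k, (rk.A j k : ℂ) • (g k - G' k) +
        ρ j)) := by
      rw [Pi.sub_apply, hW i, hU i, ← Finset.sum_sub_distrib]
      refine Finset.sum_congr rfl fun j _ => ?_
      rw [← map_sub]
      simp only [smul_sub, Finset.sum_sub_distrib, Pi.zero_apply]
      congr 1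
      abel
    rw [h1]
    refine (norm_sum_apply_le hK0 (hP i) fun j => ?_).trans_eq (by rw [Fintype.card_fin])
    exact (norm_add_le _ _).trans (add_le_add le_rfl (hinner j))
  -- `Y` contains `‖W - U‖` itself; its contribution `hc‖W - U‖` is absorbed into the left side, at
  -- the price of a factor `2`.
  have hE' : ‖W - U‖ ≤ 2 * (s * K) * (‖w - v‖ + h * (s * α * (Kp * X * δ)) + τ) := by
    have h1 : s * K * (‖w - v‖ + (h * (s * α * Y) + τ)) = h * c * ‖W - U‖ +
        s * K * (‖w - v‖ + h * (s * α * (Kp * X * δ)) + τ) := by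
      rw [hY, hc]; ring
    rw [h1] at hE
    have h2 := mul_le_mul_of_nonneg_right hch (norm_nonneg (W - U))
    linarith
  -- Both updates use the same operators, so the difference is linear in the errors, and the old
  -- error is acted on only by `R`, with factor one.
  have hdiff : w' - v' = R (w - v) + ∑ j, Q j ((h : ℂ) • ∑ k, (rk.A j k : ℂ) • (g k - G' k) + ρ j)
      + (h : ℂ) • ∑ i, (rk.b i : ℂ) • (g i - G' i) + ρ' := by
    have h1 : ∀ j, Q j ((h : ℂ) • ∑ k, (rk.A j k : ℂ) • (g k - G' k) + ρ j) =
        Q j ((h : ℂ) • ∑ k, (rk.A j k : ℂ) • g k + ρ j) -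
          Q j ((h : ℂ) • ∑ k, (rk.A j k : ℂ) • G' k + (0 : Fin s → Ω.Sobolev σ) j) := fun j => by
      rw [← map_sub]
      simp only [smul_sub, Finset.sum_sub_distrib, Pi.zero_apply]
      congr 1
      abel
    rw [hw', hv', Finset.sum_congr rfl fun j _ => h1 j]
    simp only [map_sub, smul_sub, Finset.sum_sub_distrib]
    abel
  have hfin : ‖w' - v'‖ ≤ ‖w - v‖ + s * K * (h * (s * α * Y) + τ) + h * (s * α * Y) + τ := by
    rw [hdiff]
    refine (norm_add_le _ _).trans (add_le_add ((norm_add_le _ _).trans (add_le_add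
      ((norm_add_le _ _).trans (add_le_add (hR _) ?_)) ?_)) hτ')
    · exact (norm_sum_apply_le hK0 hQ hinner).trans_eq (by rw [Fintype.card_fin])
    · rw [norm_smul, Complex.norm_real, Real.norm_of_nonneg hh0.le]
      refine mul_le_mul_of_nonneg_left ?_ hh0.le
      exact (norm_sum_smul_le hα0 hβ hgG).trans_eq (by rw [Fintype.card_fin])
  have h3 : ‖w' - v'‖ ≤ ‖w - v‖ + h * (A * (Kp * M) * ‖W - U‖) + h * (B₂ * δ) + B₃ * τ := by
    refine hfin.trans_eq ?_
    rw [hY, hA, hB₂, hB₃, hA]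
    ring
  have h4 : h * (A * (Kp * M) * ‖W - U‖) ≤ C₁ * h * ‖w - v‖ + B₁ * (h * δ) + C₁ * τ := by
    calc _ ≤ h * (A * (Kp * M) * (2 * (s * K) *
          (‖w - v‖ + h * (s * α * (Kp * X * δ)) + τ))) := by gcongr
      _ = C₁ * h * ‖w - v‖ + h * (B₁ * (h * δ)) + h * (C₁ * τ) := by
          rw [hB₁, hC₁]; ring
      _ ≤ _ := by
          refine add_le_add (add_le_add le_rfl ?_) ?_
          · exact mul_le_of_le_one_left (by positivity) hh1
          · exact mul_le_of_le_one_left (by positivity) hh1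
  have h5 : 0 ≤ (B₁ + B₂ + B₃) * (h * ‖w - v‖) := by positivity
  have h6 : 0 ≤ (C₁ + B₃) * (h * δ) := by positivity
  have h7 : 0 ≤ (B₁ + B₂) * τ := by positivity
  linarith

end Step

/-! ### Taylor expansion, quadrature errors and exactness of collocation -/

section Taylor

variable {E : Type*} [NormedAddCommGroup E] [NormedSpace ℝ E]

/-- The mean value inequality between `t` and `x` for `u` minus the integrated polynomial, whose
derivative is the remainder of `f`. No integral of `E`-valued functions is needed, hence no
completeness of `E`. -/
theorem norm_sub_sum_antideriv_le {u f : ℝ → E} {a b : ℝ}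
    (hu : ∀ x ∈ Icc a b, HasDerivAt u (f x) x) {n : ℕ} {K : ℝ} (hK : 0 ≤ K) {t : ℝ}
    (ht : t ∈ Icc a b) {v : ℕ → E}
    (hv : ∀ x ∈ Icc a b, ‖f x - ∑ k ∈ Finset.range n, (x - t) ^ k • v k‖ ≤ K * |x - t| ^ n) :
    ∀ x ∈ Icc a b, ‖u x - u t - ∑ k ∈ Finset.range n, ((x - t) ^ (k + 1) / (k + 1)) • v k‖ ≤
      K * |x - t| ^ (n + 1) := by
  intro x hx
  have hsub : uIcc t x ⊆ Icc a b := Set.uIcc_subset_Icc ht hx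
  have hd : ∀ y ∈ uIcc t x, HasDerivWithinAt
      (fun y => u y - ∑ k ∈ Finset.range n, ((y - t) ^ (k + 1) / (k + 1)) • v k)
      (f y - ∑ k ∈ Finset.range n, (y - t) ^ k • v k) (uIcc t x) y := by
    intro y hy
    refine ((hu y (hsub hy)).sub (HasDerivAt.fun_sum fun k _ => ?_)).hasDerivWithinAt
    have h1 : HasDerivAt (fun y : ℝ => (y - t) ^ (k + 1) / ((k : ℝ) + 1)) ((y - t) ^ k) y := by
      have h2 := (((hasDerivAt_id y).sub_const t).pow (k + 1)).div_const ((k : ℝ) + 1)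
      refine h2.congr_deriv ?_
      have : (k : ℝ) + 1 ≠ 0 := by positivity
      push_cast
      simp only [id]
      field_simp
    exact h1.smul_const (v k)
  have hb : ∀ y ∈ uIcc t x, ‖f y - ∑ k ∈ Finset.range n, (y - t) ^ k • v k‖ ≤
      K * |x - t| ^ n := fun y hy => by
    refine (hv y (hsub hy)).trans ?_
    have := abs_sub_left_of_mem_uIcc hy
    gcongr
  have h := (convex_uIcc t x).norm_image_sub_le_of_norm_hasDerivWithin_le hd hb
    left_mem_uIcc right_mem_uIcc
  simp only [sub_self, ne_eq, Nat.add_eq_zero_iff, one_ne_zero, and_false, not_false_eq_true,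
    zero_pow, zero_div, zero_smul, Finset.sum_const_zero, sub_zero] at h
  rw [Real.norm_eq_abs, mul_assoc, ← pow_succ] at h
  refine le_trans (le_of_eq ?_) h
  congr 1
  abel

/-- Taylor expansion with a remainder that is uniform in the base point. -/
theorem exists_taylor_bound (n : ℕ) {f : ℝ → E} {lo hi a b : ℝ}
    (hf : ContDiffOn ℝ n f (Ioo lo hi)) (hab : Icc a b ⊆ Ioo lo hi) :
    ∃ K : ℝ, 0 ≤ K ∧ ∀ t ∈ Icc a b, ∃ v : ℕ → E, ∀ x ∈ Icc a b,
      ‖f x - ∑ k ∈ Finset.range n, (x - t) ^ k • v k‖ ≤ K * |x - t| ^ n := by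
  induction n generalizing f with
  | zero =>
    obtain ⟨K, hK⟩ := isCompact_Icc.exists_bound_of_continuousOn (hf.continuousOn.mono hab)
    refine ⟨max K 0, le_max_right _ _, fun t ht => ⟨0, fun x hx => ?_⟩⟩
    simpa using Or.inl (hK x hx)
  | succ n ih =>
    have hf' : ContDiffOn ℝ ((n : WithTop ℕ∞) + 1) f (Ioo lo hi) := by exact_mod_cast hf
    rw [contDiffOn_succ_iff_deriv_of_isOpen isOpen_Ioo] at hf'
    obtain ⟨K, hK0, hK⟩ := ih hf'.2.2
    refine ⟨K, hK0, fun t ht => ?_⟩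
    obtain ⟨v, hv⟩ := hK t ht
    -- The expansion of `deriv f` is integrated term by term. `K` is passed on unchanged, and so
    -- stays independent of the base point.
    refine ⟨fun k => Nat.casesOn k (f t) fun k => ((1 : ℝ) / (k + 1)) • v k, fun x hx => ?_⟩
    have hd : ∀ x ∈ Icc a b, HasDerivAt f (deriv f x) x := fun x hx =>
      ((hf'.1 x (hab hx)).differentiableAt (isOpen_Ioo.mem_nhds (hab hx))).hasDerivAt
    refine le_trans (le_of_eq ?_) (norm_sub_sum_antideriv_le hd hK0 ht hv x hx)
    rw [Finset.sum_range_succ']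
    simp only [pow_zero, one_smul, smul_smul, mul_one_div]
    congr 1
    abel

/-- Error of an interpolatory quadrature formula. -/
theorem norm_sub_quadrature_le {s : ℕ} {u f : ℝ → E} {lo hi a b : ℝ}
    (hu : ∀ x ∈ Icc a b, HasDerivAt u (f x) x) (hf : ContDiffOn ℝ s f (Ioo lo hi))
    (hab : Icc a b ⊆ Ioo lo hi) {c : Fin s → ℝ} (hc : ∀ j, c j ∈ Icc (0 : ℝ) 1)
    {β : Fin s → ℝ} {θ : ℝ} (hθ : θ ∈ Icc (0 : ℝ) 1)
    (hβ : ∀ k < s, ∑ j, β j * c j ^ k = θ ^ (k + 1) / (k + 1)) :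
    ∃ K : ℝ, 0 ≤ K ∧ ∀ t h : ℝ, 0 ≤ h → t ∈ Icc a b → t + h ∈ Icc a b →
      ‖u (t + θ * h) - u t - h • ∑ j, β j • f (t + c j * h)‖ ≤ K * h ^ (s + 1) := by
  obtain ⟨K, hK0, hK⟩ := exists_taylor_bound s hf hab
  refine ⟨K * (1 + ∑ j, |β j|), by positivity, fun t h hh ht hth => ?_⟩
  obtain ⟨v, hv⟩ := hK t ht
  have hmem : ∀ c ∈ Icc (0 : ℝ) 1, t + c * h ∈ Icc a b := fun c hc => by
    have h1 := mul_nonneg hc.1 hh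
    have h2 := mul_le_of_le_one_left hh hc.2
    exact ⟨by linarith [ht.1], by linarith [hth.2]⟩
  have habs : ∀ c ∈ Icc (0 : ℝ) 1, |t + c * h - t| ≤ h := fun c hc => by
    rw [add_sub_cancel_left, abs_of_nonneg (mul_nonneg hc.1 hh)]
    exact mul_le_of_le_one_left hh hc.2
  have h1 := (norm_sub_sum_antideriv_le hu hK0 ht hv _ (hmem θ hθ)).trans
    (mul_le_mul_of_nonneg_left (pow_le_pow_left₀ (abs_nonneg _) (habs θ hθ) (s + 1)) hK0)
  have h2 : ∀ j, ‖f (t + c j * h) - ∑ k ∈ Finset.range s, (t + c j * h - t) ^ k • v k‖ ≤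
      K * h ^ s := fun j => (hv _ (hmem _ (hc j))).trans
    (mul_le_mul_of_nonneg_left (pow_le_pow_left₀ (abs_nonneg _) (habs _ (hc j)) s) hK0)
  -- The quadrature is exact on the Taylor polynomial by `hβ`, so only the remainders of `u` and of
  -- `f` survive.
  have h3 : u (t + θ * h) - u t - h • ∑ j, β j • f (t + c j * h) =
      (u (t + θ * h) - u t -
        ∑ k ∈ Finset.range s, ((t + θ * h - t) ^ (k + 1) / (k + 1)) • v k) -
      h • ∑ j, β j • (f (t + c j * h) - ∑ k ∈ Finset.range s, (t + c j * h - t) ^ k • v k) := by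
    have h4 : ∑ k ∈ Finset.range s, ((t + θ * h - t) ^ (k + 1) / (k + 1)) • v k =
        h • ∑ j, β j • ∑ k ∈ Finset.range s, (t + c j * h - t) ^ k • v k := by
      simp only [Finset.smul_sum, smul_smul]
      rw [Finset.sum_comm]
      refine Finset.sum_congr rfl fun k hk => ?_
      rw [← Finset.sum_smul]
      congr 1
      have h5 : ∀ j, h * (β j * (t + c j * h - t) ^ k) = h ^ (k + 1) * (β j * c j ^ k) :=
        fun j => by rw [add_sub_cancel_left]; ring
      simp only [h5, ← Finset.mul_sum, hβ k (Finset.mem_range.1 hk)]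
      rw [add_sub_cancel_left]
      ring
    rw [h4]
    simp only [smul_sub, Finset.sum_sub_distrib]
    abel
  rw [h3]
  refine (norm_sub_le _ _).trans ?_
  have h6 : ‖h • ∑ j, β j • (f (t + c j * h) -
      ∑ k ∈ Finset.range s, (t + c j * h - t) ^ k • v k)‖ ≤ h * ∑ j, |β j| * (K * h ^ s) := by
    rw [norm_smul, Real.norm_of_nonneg hh]
    refine mul_le_mul_of_nonneg_left (norm_sum_le_of_le _ fun j _ => ?_) hh
    rw [norm_smul, Real.norm_eq_abs]
    exact mul_le_mul_of_nonneg_left (h2 j) (abs_nonneg _)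
  refine (add_le_add h1 h6).trans_eq ?_
  rw [← Finset.sum_mul]
  ring

end Taylor

/-- A monomial of degree `< s` equals its interpolant at the `s` nodes, and integrating the
interpolant over `[0, θ]` produces the weights. The cases `θ = cᵢ` and `θ = 1` cover the rows of `A`
and the vector `b`. -/
theorem RungeKutta.IsCollocation.sum_mul_pow {s : ℕ} {rk : RungeKutta s} (h : rk.IsCollocation)
    {β : Fin s → ℝ} {θ : ℝ}
    (hβ : ∀ j, β j = ∫ τ in (0 : ℝ)..θ, (Lagrange.basis Finset.univ rk.c j).eval τ)
    {k : ℕ} (hk : k < s) : ∑ j, β j * rk.c j ^ k = θ ^ (k + 1) / (k + 1) := by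
  have h1 : (Polynomial.X ^ k : Polynomial ℝ) =
      ∑ j, Polynomial.C (rk.c j ^ k) * Lagrange.basis Finset.univ rk.c j := by
    have := Lagrange.eq_interpolate (s := Finset.univ) (v := rk.c) (f := Polynomial.X ^ k)
      h.1.injOn (by
        rw [Polynomial.degree_X_pow, Finset.card_univ, Fintype.card_fin]
        exact_mod_cast hk)
    rw [Lagrange.interpolate_apply] at this
    simpa using this
  have h2 : ∀ τ : ℝ, τ ^ k = ∑ j, rk.c j ^ k * (Lagrange.basis Finset.univ rk.c j).eval τ :=
    fun τ => by
      have := congrArg (Polynomial.eval τ) h1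
      simpa [Polynomial.eval_finsetSum] using this
  have h3 : ∫ τ in (0 : ℝ)..θ, τ ^ k = θ ^ (k + 1) / (k + 1) := by
    rw [integral_pow]
    simp
  rw [← h3, intervalIntegral.integral_congr fun τ _ => h2 τ]
  rw [intervalIntegral.integral_finsetSum fun j _ =>
    (Continuous.intervalIntegrable (by fun_prop) _ _)]
  refine Finset.sum_congr rfl fun j _ => ?_
  rw [intervalIntegral.integral_const_mul, hβ]
  ring

/-! ### Extrapolation of the auxiliary variables: consistency and strong stability -/

section Matrices

variable {E : Type*} [NormedAddCommGroup E] [NormedSpace ℂ E] {s : ℕ}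

/-- Consistency of the extrapolation `Γₙ = D Γₙ₋₁ + Θ N(uₙ)`. -/
theorem IsConsistent.exists_norm_sub_le {c : Fin s → ℝ} {D : Matrix (Fin s) (Fin s) ℂ} {Θ : Fin s → ℂ}
    (hD : IsConsistent c D Θ) (hc : ∀ j, c j ∈ Icc (0 : ℝ) 1) {f : ℝ → E} {lo hi a b : ℝ}
    (hf : ContDiffOn ℝ s f (Ioo lo hi)) (hab : Icc a b ⊆ Ioo lo hi) :
    ∃ K : ℝ, 0 ≤ K ∧ ∀ t h : ℝ, 0 ≤ h → t - h ∈ Icc a b → t + h ∈ Icc a b → ∀ i,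
      ‖f (t + c i * h) - (∑ j, D i j • f (t - h + c j * h) + Θ i • f t)‖ ≤ K * h ^ s := by
  obtain ⟨K, hK0, hK⟩ := exists_taylor_bound s hf hab
  obtain ⟨B, hB⟩ := (Set.finite_range fun i => 1 + (∑ j, ‖D i j‖ + ‖Θ i‖)).bddAbove
  refine ⟨K * max B 0, by positivity, fun t h hh ht1 ht2 i => ?_⟩
  have ht : t ∈ Icc a b := ⟨ht1.1.trans (by linarith), le_trans (by linarith) ht2.2⟩
  obtain ⟨v, hv⟩ := hK t ht
  have hv' : ∀ x, |x| ≤ h → ‖f (t + x) - ∑ k ∈ Finset.range s, (x : ℂ) ^ k • v k‖ ≤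
      K * h ^ s := fun x hx => by
    have h1 := abs_le.1 hx
    have h2 := hv (t + x) ⟨by linarith [ht1.1], by linarith [ht2.2]⟩
    rw [add_sub_cancel_left] at h2
    have h3 : ∀ k, (x : ℂ) ^ k • v k = x ^ k • v k := fun k => by
      rw [← Complex.ofReal_pow, Complex.coe_smul]
    simp only [h3]
    exact h2.trans (mul_le_mul_of_nonneg_left (pow_le_pow_left₀ (abs_nonneg _) hx s) hK0)
  -- Column `k` of the consistency identity says that the extrapolation reproduces `τ ↦ τ^k` from
  -- its values at `cⱼ - 1` and at `0`. The convention `0⁰ = 1` encodes that `Θ` occupies only the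
  -- first column.
  have hcons : ∀ k < s, (c i : ℂ) ^ k = ∑ j, D i j * ((c j : ℂ) - 1) ^ k + Θ i * 0 ^ k := by
    intro k hk
    have h1 := congrFun (congrFun hD i) ⟨k, hk⟩
    rw [Matrix.add_apply, Matrix.mul_apply] at h1
    simp only [Matrix.vandermonde_apply, Matrix.of_apply] at h1
    rw [h1, zero_pow_eq, mul_ite, mul_one, mul_zero]
  have e1 := hv' (c i * h) (by
    rw [abs_of_nonneg (mul_nonneg (hc i).1 hh)]
    exact mul_le_of_le_one_left hh (hc i).2)
  have e2 : ∀ j, ‖f (t - h + c j * h) -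
      ∑ k ∈ Finset.range s, (((c j - 1) * h : ℝ) : ℂ) ^ k • v k‖ ≤ K * h ^ s := fun j => by
    have := hv' ((c j - 1) * h) (by
      rw [abs_mul, abs_of_nonneg hh]
      exact mul_le_of_le_one_left hh (abs_le.2 ⟨by linarith [(hc j).1], by linarith [(hc j).2]⟩))
    rwa [show t + (c j - 1) * h = t - h + c j * h by ring] at this
  have e3 := hv' 0 (by simpa using hh)
  rw [add_zero] at e3
  have key : ∑ k ∈ Finset.range s, ((c i * h : ℝ) : ℂ) ^ k • v k =
      ∑ j, D i j • ∑ k ∈ Finset.range s, (((c j - 1) * h : ℝ) : ℂ) ^ k • v k +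
        Θ i • ∑ k ∈ Finset.range s, ((0 : ℝ) : ℂ) ^ k • v k := by
    simp only [Finset.smul_sum, smul_smul]
    rw [Finset.sum_comm, ← Finset.sum_add_distrib]
    refine Finset.sum_congr rfl fun k hk => ?_
    rw [← Finset.sum_smul, ← add_smul]
    congr 1
    push_cast
    simp only [mul_pow]
    rw [hcons k (Finset.mem_range.1 hk), add_mul, Finset.sum_mul]
    congr 1
    · exact Finset.sum_congr rfl fun j _ => by ring
    · rcases k with _ | k <;> simp
  have hsplit : f (t + c i * h) - (∑ j, D i j • f (t - h + c j * h) + Θ i • f t) =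
      (f (t + c i * h) - ∑ k ∈ Finset.range s, ((c i * h : ℝ) : ℂ) ^ k • v k) -
      (∑ j, D i j • (f (t - h + c j * h) -
        ∑ k ∈ Finset.range s, (((c j - 1) * h : ℝ) : ℂ) ^ k • v k) +
        Θ i • (f t - ∑ k ∈ Finset.range s, ((0 : ℝ) : ℂ) ^ k • v k)) := by
    simp only [smul_sub, Finset.sum_sub_distrib]
    rw [key]
    abel
  rw [hsplit]
  have hbd : 1 + (∑ j, ‖D i j‖ + ‖Θ i‖) ≤ max B 0 := (hB ⟨i, rfl⟩).trans (le_max_left _ _)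
  calc _ ≤ K * h ^ s + (∑ j, ‖D i j‖ * (K * h ^ s) + ‖Θ i‖ * (K * h ^ s)) := by
        refine (norm_sub_le _ _).trans (add_le_add e1 ((norm_add_le _ _).trans (add_le_add
          (norm_sum_le_of_le _ fun j _ => ?_) ?_)))
        · rw [norm_smul]
          exact mul_le_mul_of_nonneg_left (e2 j) (norm_nonneg _)
        · rw [norm_smul]
          exact mul_le_mul_of_nonneg_left e3 (norm_nonneg _)
    _ = K * h ^ s * (1 + (∑ j, ‖D i j‖ + ‖Θ i‖)) := by rw [← Finset.sum_mul]; ring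
    _ ≤ K * h ^ s * max B 0 := by gcongr
    _ = _ := by ring

/-- The action of a complex matrix on a vector with entries in a normed space. -/
def matrixAction (D : Matrix (Fin s) (Fin s) ℂ) (x : Fin s → E) : Fin s → E :=
  fun i => ∑ j, D i j • x j

theorem matrixAction_one (x : Fin s → E) : matrixAction 1 x = x := by
  ext i
  simp [matrixAction, Matrix.one_apply]

theorem matrixAction_mul (D D' : Matrix (Fin s) (Fin s) ℂ) (x : Fin s → E) :
    matrixAction (D * D') x = matrixAction D (matrixAction D' x) := by
  ext i
  simp only [matrixAction, Matrix.mul_apply, Finset.sum_smul, Finset.smul_sum, mul_smul]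
  exact Finset.sum_comm

theorem matrixAction_add (D : Matrix (Fin s) (Fin s) ℂ) (x y : Fin s → E) :
    matrixAction D (x + y) = matrixAction D x + matrixAction D y := by
  ext i
  simp [matrixAction, Finset.sum_add_distrib]

theorem norm_matrixAction_le {D : Matrix (Fin s) (Fin s) ℂ} {B : ℝ} (hB0 : 0 ≤ B)
    (hB : ∀ i, ∑ j, ‖D i j‖ ≤ B) (x : Fin s → E) : ‖matrixAction D x‖ ≤ B * ‖x‖ := by
  rw [pi_norm_le_iff_of_nonneg (by positivity)]
  intro i
  refine (norm_sum_le_of_le _ (n := fun j => ‖D i j‖ * ‖x‖) fun j _ => ?_).trans ?_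
  · rw [norm_smul]
    exact mul_le_mul_of_nonneg_left (norm_le_pi_norm x j) (norm_nonneg _)
  · rw [← Finset.sum_mul]
    exact mul_le_mul_of_nonneg_right (hB i) (norm_nonneg _)

theorem exists_row_sum_bound (D : Matrix (Fin s) (Fin s) ℂ) :
    ∃ B : ℝ, 0 ≤ B ∧ ∀ i, ∑ j, ‖D i j‖ ≤ B := by
  obtain ⟨B, hB⟩ := (Set.finite_range fun i => ∑ j, ‖D i j‖).bddAbove
  exact ⟨max B 0, le_max_right _ _, fun i => (hB ⟨i, rfl⟩).trans (le_max_left _ _)⟩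

-- Gelfand's formula for the maximal row sum norm, with `ρ` strictly between the spectral radius and
-- `1`. Row sums also bound the action on vectors with entries in a normed space.
attribute [local instance] Matrix.linftyOpNormedRing Matrix.linftyOpNormedAlgebra in
theorem IsStronglyStable.exists_pow {D : Matrix (Fin s) (Fin s) ℂ} (hD : IsStronglyStable D) :
    ∃ ρ : ℝ, 0 < ρ ∧ ρ < 1 ∧ ∃ p : ℕ, 0 < p ∧ ∀ i, ∑ j, ‖(D ^ p) i j‖ ≤ ρ ^ p := by
  have : CompleteSpace (Matrix (Fin s) (Fin s) ℂ) := FiniteDimensional.complete ℂ _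
  obtain ⟨ρ, h1, h2⟩ := ENNReal.lt_iff_exists_nnreal_btwn.1 hD
  have hρ1 : ρ < 1 := by exact_mod_cast h2
  have hρ0 : 0 < ρ := by
    have h3 : (0 : ENNReal) < ρ := bot_le.trans_lt h1
    exact_mod_cast h3
  refine ⟨ρ, hρ0, hρ1, ?_⟩
  have h3 := (spectrum.pow_nnnorm_pow_one_div_tendsto_nhds_spectralRadius D).eventually
    (gt_mem_nhds h1)
  obtain ⟨p, hp, hp0⟩ := (h3.and (Filter.eventually_gt_atTop 0)).exists
  refine ⟨p, hp0, fun i => ?_⟩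
  have h4 : ‖D ^ p‖₊ ≤ ρ ^ p := by
    have h5 := ENNReal.rpow_le_rpow hp.le (z := (p : ℝ)) (by positivity)
    rw [← ENNReal.rpow_mul, one_div_mul_cancel (by exact_mod_cast hp0.ne'), ENNReal.rpow_one,
      ENNReal.rpow_natCast] at h5
    exact_mod_cast h5
  have h6 : ∑ j, ‖(D ^ p) i j‖₊ ≤ ‖D ^ p‖₊ := by
    rw [Matrix.linfty_opNNNorm_def]
    exact Finset.le_sup (f := fun i => ∑ j, ‖(D ^ p) i j‖₊) (Finset.mem_univ i)
  have h7 := NNReal.coe_le_coe.2 (h6.trans h4)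
  push_cast at h7
  exact h7

variable (E) in
/-- A strongly stable matrix is a strict contraction for an equivalent norm. -/
theorem IsStronglyStable.exists_contracting_norm {D : Matrix (Fin s) (Fin s) ℂ}
    (hD : IsStronglyStable D) :
    ∃ ρ : ℝ, 0 < ρ ∧ ρ < 1 ∧ ∃ K : ℝ, 0 ≤ K ∧ ∃ nrm : (Fin s → E) → ℝ,
      (∀ x, ‖x‖ ≤ nrm x) ∧ (∀ x, nrm x ≤ K * ‖x‖) ∧ (∀ x y, nrm (x + y) ≤ nrm x + nrm y) ∧
      ∀ x, nrm (matrixAction D x) ≤ ρ * nrm x := by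
  obtain ⟨ρ, hρ0, hρ1, p, hp, hDp⟩ := hD.exists_pow
  choose B hB0 hB using fun k : ℕ => exists_row_sum_bound (D ^ k)
  -- The adapted norm is `Σ_{k<p} ρ^(-k) ‖Dᵏx‖`; its term `k = 0` is `‖x‖`, and positivity of `ρ`
  -- makes the weights meaningful.
  refine ⟨ρ, hρ0, hρ1, ∑ k ∈ Finset.range p, (ρ ^ k)⁻¹ * B k, by
    exact Finset.sum_nonneg fun k _ => mul_nonneg (by positivity) (hB0 k),
    fun x => ∑ k ∈ Finset.range p, (ρ ^ k)⁻¹ * ‖matrixAction (D ^ k) x‖, fun x => ?_, fun x => ?_,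
    fun x y => ?_, fun x => ?_⟩
  · have h1 := Finset.single_le_sum (f := fun k => (ρ ^ k)⁻¹ * ‖matrixAction (D ^ k) x‖)
      (fun k _ => by positivity) (Finset.mem_range.2 hp)
    simpa [matrixAction_one] using h1
  · rw [Finset.sum_mul]
    refine Finset.sum_le_sum fun k _ => ?_
    rw [mul_assoc]
    exact mul_le_mul_of_nonneg_left (norm_matrixAction_le (hB0 k) (hB k) x) (by positivity)
  · rw [← Finset.sum_add_distrib]
    refine Finset.sum_le_sum fun k _ => ?_
    rw [← mul_add, matrixAction_add]
    exact mul_le_mul_of_nonneg_left (norm_add_le _ _) (by positivity)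
  -- Applying `D` shifts the sum by one index and yields a factor `ρ`. The new term `k = p` is at
  -- most `‖x‖`, the term `k = 0` that is lost.
  · set F : ℕ → ℝ := fun k => (ρ ^ k)⁻¹ * ‖matrixAction (D ^ k) x‖ with hF
    have h1 : ∀ k, (ρ ^ k)⁻¹ * ‖matrixAction (D ^ k) (matrixAction D x)‖ = ρ * F (k + 1) :=
      fun k => by
        rw [← matrixAction_mul, ← pow_succ, hF]
        simp only [pow_succ, mul_inv]
        field_simp
    simp only [h1, ← Finset.mul_sum]
    refine mul_le_mul_of_nonneg_left ?_ hρ0.le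
    have h2 := Finset.sum_range_succ F p
    rw [Finset.sum_range_succ'] at h2
    have h3 : F 0 = ‖x‖ := by simp [hF, matrixAction_one]
    have h4 : F p ≤ ‖x‖ := by
      have h5 := norm_matrixAction_le (by positivity) hDp x
      rw [hF]
      calc _ ≤ (ρ ^ p)⁻¹ * (ρ ^ p * ‖x‖) := mul_le_mul_of_nonneg_left h5 (by positivity)
        _ = ‖x‖ := by field_simp
    linarith

end Matrices

/-! ### Gronwall argument, generation of the sequences, stability region, defects -/

/-- A discrete Gronwall inequality for a system `(a, d)` whose one-step estimates hold as long as
`a` and `d` stay below the thresholds `η'` and `η`. -/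
theorem discrete_gronwall_bootstrap {a d : ℕ → ℝ} {h T ρ κ C C₂ C₃ Kq η η' x₀ e : ℝ}
    (ha : ∀ n, 0 ≤ a n) (hd : ∀ n, 0 ≤ d n) (hh : 0 < h) (hρ : 0 ≤ ρ) (hκ0 : 0 ≤ κ)
    (hC₂ : 0 ≤ C₂) (hC₃ : 0 ≤ C₃) (hKq : 0 ≤ Kq) (he : 0 ≤ e)
    (hκ : (C₂ + κ) * ρ = κ) (hC : C = C₂ + (C₂ + κ) * C₃ + C₂ * Kq)
    (hx₀ : a 0 + κ * h * d 0 ≤ x₀) (hd₀ : d 0 ≤ η)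
    (hsmall : Real.exp (C * T) * (x₀ + T * C * e) ≤ η') (hη : ρ * η + C₃ * (η' + e) ≤ η)
    (hstep : ∀ n : ℕ, ((n + 1 : ℕ) : ℝ) * h ≤ T → a n ≤ η' → d n ≤ η →
      d (n + 1) ≤ ρ * d n + C₃ * (a n + e) ∧
        a (n + 1) ≤ (1 + C₂ * h) * a n + C₂ * (h * d (n + 1) + Kq * (h * e))) :
    ∀ n : ℕ, n * h ≤ T →
      a n ≤ Real.exp (C * (n * h)) * (x₀ + n * h * C * e) ∧ a n ≤ η' ∧ d n ≤ η := by
  have hC0 : 0 ≤ C := by rw [hC]; positivity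
  have hx₀0 : 0 ≤ x₀ := le_trans (by have := ha 0; have := hd 0; positivity) hx₀
  have hbound : ∀ n : ℕ, n * h ≤ T →
      Real.exp (C * (n * h)) * (x₀ + n * h * C * e) ≤ η' := fun n hn => by
    refine le_trans ?_ hsmall
    have : 0 ≤ (n : ℝ) * h := by positivity
    gcongr
  -- The induction carries the Gronwall bound for `a + κhd` together with `d ≤ η`. By `hbound` the
  -- first also yields `a ≤ η'`, which is what the next step estimate requires.
  have main : ∀ n : ℕ, n * h ≤ T →
      a n + κ * h * d n ≤ Real.exp (C * (n * h)) * (x₀ + n * h * C * e) ∧ d n ≤ η := by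
    intro n
    induction n with
    | zero => exact fun _ => ⟨by simpa using hx₀, hd₀⟩
    | succ n ih =>
      intro hn
      have hn' : (n : ℝ) * h ≤ T := le_trans (by push_cast; nlinarith) hn
      obtain ⟨h1, h2⟩ := ih hn'
      have hdn := hd n
      have han := ha n
      have h3 : a n ≤ η' := le_trans (le_trans (le_add_of_nonneg_right (by positivity)) h1)
        (hbound n hn')
      obtain ⟨h4, h5⟩ := hstep n hn h3 h2
      constructor
      · have h6 : a (n + 1) + κ * h * d (n + 1) ≤
            (1 + C * h) * (a n + κ * h * d n) + C * h * e := by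
          calc a (n + 1) + κ * h * d (n + 1) ≤
                (1 + C₂ * h) * a n + C₂ * (h * d (n + 1) + Kq * (h * e)) + κ * h * d (n + 1) := by
                linarith
            _ = (1 + C₂ * h) * a n + (C₂ + κ) * h * d (n + 1) + C₂ * Kq * (h * e) := by ring
            _ ≤ (1 + C₂ * h) * a n + (C₂ + κ) * h * (ρ * d n + C₃ * (a n + e)) +
                C₂ * Kq * (h * e) := by gcongr
            _ = (1 + C₂ * h) * a n + (C₂ + κ) * ρ * (h * d n) +
                (C₂ + κ) * C₃ * (h * (a n + e)) + C₂ * Kq * (h * e) := by ring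
            _ = (1 + (C₂ + (C₂ + κ) * C₃) * h) * a n + κ * h * d n +
                ((C₂ + κ) * C₃ + C₂ * Kq) * h * e := by rw [hκ]; ring
            _ ≤ (1 + C * h) * a n + (1 + C * h) * (κ * h * d n) + C * h * e := by
                have e1 : 0 ≤ C₂ * Kq := by positivity
                refine add_le_add (add_le_add ?_ ?_) ?_
                · gcongr
                  rw [hC]; linarith
                · exact le_mul_of_one_le_left (by positivity)
                    (le_add_of_nonneg_right (by positivity))
                · gcongr
                  rw [hC]; linarith
            _ = _ := by ring
        have h7 : 1 + C * h ≤ Real.exp (C * h) := by linarith [Real.add_one_le_exp (C * h)]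
        have h8 : Real.exp (C * ((n + 1 : ℕ) * h)) =
            Real.exp (C * h) * Real.exp (C * (n * h)) := by
          rw [← Real.exp_add]; congr 1; push_cast; ring
        have h9 : 1 ≤ Real.exp (C * ((n + 1 : ℕ) * h)) := Real.one_le_exp (by positivity)
        calc _ ≤ _ := h6
          _ ≤ Real.exp (C * h) * (Real.exp (C * (n * h)) * (x₀ + n * h * C * e)) +
              Real.exp (C * ((n + 1 : ℕ) * h)) * (C * h * e) := by
              refine add_le_add (mul_le_mul h7 h1 (by positivity) (Real.exp_pos _).le) ?_
              exact le_mul_of_one_le_left (by positivity) h9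
          _ = _ := by rw [h8]; push_cast; ring
      · calc d (n + 1) ≤ ρ * d n + C₃ * (a n + e) := h4
          _ ≤ ρ * η + C₃ * (η' + e) := by gcongr
          _ ≤ η := hη
  intro n hn
  obtain ⟨h1, h2⟩ := main n hn
  have hdn := hd n
  have h3 : a n ≤ Real.exp (C * (n * h)) * (x₀ + n * h * C * e) :=
    le_trans (le_add_of_nonneg_right (by positivity)) h1
  exact ⟨h3, h3.trans (hbound n hn), h2⟩

/-- Existence of the sequences generated by the method, as long as each step can be carried out. -/
theorem exists_method_sequence {Ω : FourierDomain} {σ : ℝ} {s : ℕ} (rk : RungeKutta s)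
    (L : LinearPart) (N : Ω.Sobolev σ → Ω.Sobolev σ) (D : Matrix (Fin s) (Fin s) ℂ)
    (Θ : Fin s → ℂ) (h : ℝ) (u₀ : Ω.Sobolev σ) (γ₀ : Fin s → Ω.Sobolev σ) :
    ∃ (un : ℕ → Ω.Sobolev σ) (Γ U : ℕ → Fin s → Ω.Sobolev σ), un 0 = u₀ ∧ Γ 0 = γ₀ ∧
      (∀ n, Γ (n + 1) = gammaStep D Θ N (Γ n) (un n)) ∧
      ∀ n, (∃ U' v', IsStageSolution rk L h (un n) (Γ (n + 1)) U' ∧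
          (∀ U'', IsStageSolution rk L h (un n) (Γ (n + 1)) U'' → U'' = U') ∧
          IsUpdate rk L h (un n) (Γ (n + 1)) U' v') →
        IsStageSolution rk L h (un n) (Γ (n + 1)) (U n) ∧
          (∀ U'', IsStageSolution rk L h (un n) (Γ (n + 1)) U'' → U'' = U n) ∧
          IsUpdate rk L h (un n) (Γ (n + 1)) (U n) (un (n + 1)) := by
  have hF : ∀ (v : Ω.Sobolev σ) (γ : Fin s → Ω.Sobolev σ),
      ∃ p : (Fin s → Ω.Sobolev σ) × Ω.Sobolev σ,
        (∃ U' v', IsStageSolution rk L h v γ U' ∧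
          (∀ U'', IsStageSolution rk L h v γ U'' → U'' = U') ∧ IsUpdate rk L h v γ U' v') →
        IsStageSolution rk L h v γ p.1 ∧ (∀ U'', IsStageSolution rk L h v γ U'' → U'' = p.1) ∧
          IsUpdate rk L h v γ p.1 p.2 := by
    intro v γ
    by_cases hex : ∃ U' v', IsStageSolution rk L h v γ U' ∧
        (∀ U'', IsStageSolution rk L h v γ U'' → U'' = U') ∧ IsUpdate rk L h v γ U' v'
    · obtain ⟨U', v', hU⟩ := hex
      exact ⟨(U', v'), fun _ => hU⟩
    -- A default value, so that the sequences are defined for all `n` before solvability is known.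
    · exact ⟨0, fun h => (hex h).elim⟩
  choose F hF using hF
  -- The state at `n` is `(uₙ, Γₙ₋₁)`; the stages of step `n` therefore use the second entry of the
  -- state at `n + 1`.
  let st : ℕ → Ω.Sobolev σ × (Fin s → Ω.Sobolev σ) := fun n => Nat.rec (u₀, γ₀)
    (fun _ p => ((F p.1 (gammaStep D Θ N p.2 p.1)).2, gammaStep D Θ N p.2 p.1)) n
  exact ⟨fun n => (st n).1, fun n => (st n).2, fun n => (F (st n).1 (st (n + 1)).2).1, rfl, rfl,
    fun n => rfl, fun n => hF (st n).1 (st (n + 1)).2⟩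

theorem FourierDomain.hat_surjective_of_standard {d : ℕ} {Ω : FourierDomain}
    (hΩ : Ω = wholeSpace d ∨ Ω = torus d) (F : Lp ℂ 2 Ω.ν) : ∃ p, Ω.hat p = F := by
  rcases hΩ with rfl | rfl
  · exact wholeSpace_hat_surjective d F
  · exact torus_hat_surjective d F

theorem FourierDomain.exists_isProduct_of_standard {d : ℕ} {Ω : FourierDomain}
    (hΩ : Ω = wholeSpace d ∨ Ω = torus d) {σ : ℝ} (hσ : (d : ℝ) / 2 < σ) :
    ∃ K : ℝ, 0 ≤ K ∧ ∀ f g : Ω.Sobolev σ, ∃ w, IsProduct f g w ∧ ‖w‖ ≤ K * ‖f‖ * ‖g‖ := by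
  rcases hΩ with rfl | rfl
  · exact wholeSpace_exists_isProduct d hσ
  · exact torus_exists_isProduct d hσ

theorem FourierDomain.lap_nonpos_of_standard {d : ℕ} {Ω : FourierDomain}
    (hΩ : Ω = wholeSpace d ∨ Ω = torus d) (ξ : Ω.Freq) : Ω.lap ξ ≤ 0 := by
  rcases hΩ with rfl | rfl
  · exact neg_nonpos.2 (by positivity)
  · exact neg_nonpos.2 (mul_nonneg (by positivity) (Finset.sum_nonneg fun _ _ => sq_nonneg _))

/-- The symbol of `Δ` is real and nonpositive, so for `h > 0` that of `hL` lies on the imaginary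
axis for `L = iΔ` and in the left half-plane for `L = Δ`. -/
theorem exists_stability_region {d : ℕ} {Ω : FourierDomain}
    (hΩ : Ω = wholeSpace d ∨ Ω = torus d) {s : ℕ} {rk : RungeKutta s} {L : LinearPart}
    (hstab : (L = LinearPart.schrodinger ∧ rk.IsIHatStable) ∨
      (L = LinearPart.heat ∧ rk.IsAHatStable)) :
    ∃ S : Set ℂ, rk.StableOn S ∧ rk.RowStableOn S ∧ rk.InvStableOn S ∧
      ∀ h : ℝ, 0 < h → ∀ ξ, L.scaledSymbol Ω h ξ ∈ S := by
  rcases hstab with ⟨rfl, h1, h2, h3⟩ | ⟨rfl, h1, h2, h3⟩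
  · refine ⟨_, h1, h2, h3, fun h _ ξ => ?_⟩
    change ((h : ℂ) * (Complex.I * (Ω.lap ξ : ℂ))).re = 0
    simp
  · refine ⟨_, h1, h2, h3, fun h hh ξ => ?_⟩
    change ((h : ℂ) * (1 * (Ω.lap ξ : ℂ))).re ≤ 0
    simpa using mul_nonpos_of_nonneg_of_nonpos hh.le (lap_nonpos_of_standard hΩ ξ)

/-- Collocation defects of the exact solution. -/
theorem exists_collocation_defect_bound {E : Type*} [NormedAddCommGroup E] [NormedSpace ℂ E]
    {s : ℕ} {rk : RungeKutta s} (hcol : rk.IsCollocation) (hc : ∀ i, rk.c i ∈ Icc (0 : ℝ) 1)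
    {u f : ℝ → E} {lo hi a b : ℝ} (hu : ∀ x ∈ Icc a b, HasDerivAt u (f x) x)
    (hf : ContDiffOn ℝ s f (Ioo lo hi)) (hab : Icc a b ⊆ Ioo lo hi) :
    ∃ K : ℝ, 0 ≤ K ∧ ∀ t h : ℝ, 0 ≤ h → t ∈ Icc a b → t + h ∈ Icc a b →
      (∀ i, ‖u (t + rk.c i * h) - u t -
        (h : ℂ) • ∑ j, (rk.A i j : ℂ) • f (t + rk.c j * h)‖ ≤ K * h ^ (s + 1)) ∧
      ‖u (t + h) - u t - (h : ℂ) • ∑ i, (rk.b i : ℂ) • f (t + rk.c i * h)‖ ≤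
        K * h ^ (s + 1) := by
  choose K hK0 hK using fun i => norm_sub_quadrature_le hu hf hab hc (hc i)
    (fun k hk => hcol.sum_mul_pow (hcol.2.1 i) hk)
  obtain ⟨K', hK'0, hK'⟩ := norm_sub_quadrature_le hu hf hab hc (θ := 1) ⟨zero_le_one, le_rfl⟩
    (fun k hk => hcol.sum_mul_pow hcol.2.2 hk)
  obtain ⟨B, hB⟩ := (Set.finite_range K).bddAbove
  refine ⟨max B K', hK'0.trans (le_max_right _ _), fun t h hh ht hth => ⟨fun i => ?_, ?_⟩⟩
  · have h1 := hK i t h hh ht hth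
    simp only [Complex.coe_smul]
    exact h1.trans (mul_le_mul_of_nonneg_right ((hB ⟨i, rfl⟩).trans (le_max_left _ _))
      (by positivity))
  · have h1 := hK' t h hh ht hth
    rw [one_mul] at h1
    simp only [Complex.coe_smul]
    exact h1.trans (mul_le_mul_of_nonneg_right (le_max_right _ _) (by positivity))

/-! ### The convergence theorem -/

set_option maxHeartbeats 1600000 in
theorem mainTheorem1
    (d : ℕ) (Ω : FourierDomain) (hΩ : Ω = wholeSpace d ∨ Ω = torus d)
    (σ : ℝ) (hσ : (d : ℝ) / 2 < σ)
    (L : LinearPart) (N : Ω.Sobolev σ → Ω.Sobolev σ)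
    -- `N` maps bounded sets to bounded sets and is Lipschitz on bounded sets
    (hNbdd : ∀ B : Set (Ω.Sobolev σ), Bornology.IsBounded B → Bornology.IsBounded (N '' B))
    (hNlip : ∀ B : Set (Ω.Sobolev σ), Bornology.IsBounded B → ∃ K : NNReal, LipschitzOnWith K N B)
    -- the numerical method
    (s : ℕ) (hs : 1 ≤ s) (rk : RungeKutta s) (hcol : rk.IsCollocation)
    (hcmono : StrictMono rk.c) (hc01 : ∀ i, rk.c i ∈ Icc (0 : ℝ) 1)
    (D : Matrix (Fin s) (Fin s) ℂ) (Θ : Fin s → ℂ)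
    (hD : IsStronglyStable D) (hDΘ : IsConsistent rk.c D Θ)
    (hstab : (L = LinearPart.schrodinger ∧ rk.IsIHatStable) ∨
      (L = LinearPart.heat ∧ rk.IsAHatStable))
    -- the exact solution on `(Tlo, Thi)` with initial datum `uinit`
    (Tlo Thi T : ℝ) (hTlo : Tlo < 0) (hT : 0 < T) (hTThi : T < Thi)
    (uinit : Ω.Sobolev σ) (u : ℝ → Ω.Sobolev σ) (hu0 : u 0 = uinit)
    (hu : IsExactSolution L N u Tlo Thi)
    (husmooth : ContDiffOn ℝ ((s + 2 : ℕ) : WithTop ℕ∞) u (Ioo Tlo Thi))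
    (hNusmooth : ContDiffOn ℝ (s : WithTop ℕ∞) (fun t => N (u t)) (Ioo Tlo Thi))
    -- the constants `r`, `M`, `m`
    (r M m : ℝ) (hr : 0 < r) (hM : 0 < M) (hm : 0 < m)
    (hMbound : ∀ t ∈ Icc (0 : ℝ) T, ‖N (u t)‖ ≤ M)
    (hMm : ∀ t ∈ Icc (0 : ℝ) T, ∀ v : Ω.Sobolev σ, ‖v‖ ≤ r → ‖N (u t + v)‖ < M + m) :
    ∃ C > (0 : ℝ), ∃ h₀ > (0 : ℝ), h₀ < T ∧ h₀ < -Tlo ∧ ∃ W ∈ 𝓝 uinit, ∃ ε > (0 : ℝ),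
      ∀ u₀ ∈ W, ∀ h ∈ Ioo (0 : ℝ) h₀, ∀ γinit : Fin s → Ω.Sobolev σ,
        (∀ i, ‖N (u (-h + rk.c i * h)) - γinit i‖ < ε) →
        -- `un n` is `uₙ`, `Γ n` is `Γₙ₋₁`, and `U n` is the vector of stages of step `n`
        ∃ (un : ℕ → Ω.Sobolev σ) (Γ U : ℕ → Fin s → Ω.Sobolev σ),
          un 0 = u₀ ∧ Γ 0 = γinit ∧
          ∀ n : ℕ, n * h ≤ T →
            -- step `n` of the method is well defined
            Γ (n + 1) = gammaStep D Θ N (Γ n) (un n) ∧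
            IsStageSolution rk L h (un n) (Γ (n + 1)) (U n) ∧
            (∀ U' : Fin s → Ω.Sobolev σ,
              IsStageSolution rk L h (un n) (Γ (n + 1)) U' → U' = U n) ∧
            IsUpdate rk L h (un n) (Γ (n + 1)) (U n) (un (n + 1)) ∧
            -- the bound on the auxiliary variables
            (∀ i, ‖Γ n i‖ ≤ M + m) ∧
            -- the error estimate
            ∀ k ≤ n, ‖u (k * h) - un k‖ ≤
              Real.exp (C * n * h) * (‖uinit - u₀‖ +
                C * ((⨆ i, ‖N (u (-h + rk.c i * h)) - γinit i‖) + h ^ s)) := by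
  have hσ0 : 0 ≤ σ := le_trans (by positivity) hσ.le
  have hsurj := hat_surjective_of_standard hΩ
  have hprod := exists_isProduct_of_standard hΩ hσ
  obtain ⟨S, hst, hrow, hinv, hS⟩ := exists_stability_region hΩ hstab
  have : Nonempty (Fin s) := ⟨⟨0, hs⟩⟩
  -- A compact time window that contains `t₋₁ = -h` once `h ≤ -Tlo/2`, so that all Taylor constants
  -- are uniform.
  have hab : Icc (Tlo / 2) T ⊆ Ioo Tlo Thi := fun t ht => ⟨by linarith [ht.1], by linarith [ht.2]⟩
  -- the exact solution
  have hderiv : ∀ t ∈ Icc (Tlo / 2) T, HasDerivAt u (deriv u t) t ∧ ∃ g : Ω.Sobolev σ,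
      IsProduct (N (u t)) (u t) g ∧ hat (deriv u t) = L.applyHat (u t) + hat g := by
    intro t ht
    obtain ⟨u', g, h1, h2, h3⟩ := hu t (hab ht)
    rw [h1.deriv]
    exact ⟨h1, g, h2, h3⟩
  have hsmooth' : ContDiffOn ℝ s (deriv u) (Ioo Tlo Thi) := by
    have h1 : ContDiffOn ℝ ((s : WithTop ℕ∞) + 1) u (Ioo Tlo Thi) :=
      husmooth.of_le (by exact_mod_cast Nat.le_succ (s + 1))
    rw [contDiffOn_succ_iff_deriv_of_isOpen isOpen_Ioo] at h1
    exact h1.2.2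
  obtain ⟨X, hX⟩ := isCompact_Icc.exists_bound_of_continuousOn (husmooth.continuousOn.mono hab)
  have hX0 : 0 ≤ X := (norm_nonneg _).trans (hX 0 ⟨by linarith, hT.le⟩)
  obtain ⟨Lc, hLc⟩ := hNlip (Metric.closedBall 0 (X + 1)) Metric.isBounded_closedBall
  obtain ⟨NB, hNB⟩ := (hNbdd (Metric.closedBall 0 (X + 1))
    Metric.isBounded_closedBall).exists_norm_le
  have hNB' : ∀ v, ‖v‖ ≤ X + 1 → ‖N v‖ ≤ NB := fun v hv =>
    hNB _ ⟨v, mem_closedBall_zero_iff.2 hv, rfl⟩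
  have hNB0 : 0 ≤ NB := (norm_nonneg _).trans (hNB' 0 (by rw [norm_zero]; linarith))
  -- the constants
  obtain ⟨Dr, hDr0, hDr⟩ := exists_row_sum_bound D
  set Θm := ‖Θ‖ with hΘm
  -- A crude bound for `Γₙ` from the bounds on `Γₙ₋₁` and `uₙ`. It makes step `n` solvable even when
  -- `tₙ₊₁ > T`, where no error bound for `Γₙ` is available.
  set M' := Dr * (M + m) + Θm * NB with hM'
  have hM'0 : 0 ≤ M' := by positivity
  obtain ⟨h₁, hh₁, hstep⟩ := exists_step hσ0 hsurj hprod rk L hst hrow hinv hM'0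
  obtain ⟨C₂, hC₂0, h₂, hh₂, herr⟩ := exists_step_error hσ0 hsurj hprod rk L hst hrow hinv hM'0 hX0
  obtain ⟨Kq, hKq0, hKq⟩ := exists_collocation_defect_bound hcol hc01
    (fun t ht => (hderiv t ht).1) hsmooth' hab
  obtain ⟨Kc, hKc0, hKc⟩ := hDΘ.exists_norm_sub_le hc01 hNusmooth hab
  obtain ⟨ρ, hρ0, hρ1, Kn, hKn0, nrm, hnrm, hnrm', hnrm_add, hnrm_D⟩ :=
    hD.exists_contracting_norm (Ω.Sobolev σ)
  have hnrm0 : ∀ x, 0 ≤ nrm x := fun x => (norm_nonneg x).trans (hnrm x)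
  set C₃ := Kn * (Θm * Lc + Kc) with hC₃
  have hC₃0 : 0 ≤ C₃ := by positivity
  have hρ1' : 0 < 1 - ρ := by linarith
  set κ := C₂ * ρ / (1 - ρ) with hκ
  have hκ0 : 0 ≤ κ := by positivity
  have hκ' : (C₂ + κ) * ρ = κ := by rw [hκ]; field_simp; ring
  set C₄ := C₂ + (C₂ + κ) * C₃ + C₂ * Kq with hC₄
  have hC₄0 : 0 ≤ C₄ := by positivity
  -- Half of the margin `m` is for the error of `Γ`, the other half for `N(u)` at times before `0`
  -- (`hNcont`), which `hMbound` does not cover.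
  set η := m / 2 with hη
  have hη0 : 0 < η := by positivity
  -- With `a` and `h^s` both at most `η₁`, the recursion for `d` does not leave `[0, η]`, since
  -- `2C₃η₁ ≤ (1 - ρ)η`.
  set η₁ := (1 - ρ) * η / (2 * (C₃ + 1)) with hη₁
  have hη₁0 : 0 < η₁ := by positivity
  set η' := min 1 η₁ with hη'
  have hη'0 : 0 < η' := lt_min one_pos hη₁0
  -- The threshold `η'`, divided by the Gronwall factor, is shared equally by the initial error, the
  -- error of `γinit` and the term in `h^s`.
  set q := η' * Real.exp (-(C₄ * T)) / 3 with hq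
  have hq0 : 0 < q := by positivity
  have hq' : Real.exp (C₄ * T) * (q + q + q) = η' := by
    rw [hq, Real.exp_neg]
    field_simp
    ring
  obtain ⟨h₃, hh₃, hNcont⟩ : ∃ h₃ > (0 : ℝ), ∀ t : ℝ, |t| < h₃ → ‖N (u t)‖ ≤ M + m / 2 := by
    have h1 : ContinuousAt (fun t => ‖N (u t)‖) 0 :=
      (hNusmooth.continuousOn.continuousAt (isOpen_Ioo.mem_nhds ⟨hTlo, hT.trans hTThi⟩)).norm
    have h2 : ‖N (u 0)‖ < M + m / 2 := by linarith [hMbound 0 ⟨le_rfl, hT.le⟩]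
    obtain ⟨h₃, hh₃, h3⟩ := Metric.eventually_nhds_iff.1 (h1.eventually_lt_const h2)
    exact ⟨h₃, hh₃, fun t ht => (h3 (by simpa using ht)).le⟩
  obtain ⟨h₀, hh₀, e₁, e₂, e₃, e₄, e₅, e₆, e₇, e₈⟩ : ∃ h₀ > (0 : ℝ), h₀ ≤ h₁ ∧ h₀ ≤ h₂ ∧ h₀ ≤ h₃ ∧
      h₀ ≤ 1 ∧ h₀ ≤ T / 2 ∧ h₀ ≤ -Tlo / 2 ∧ h₀ ≤ η₁ ∧ h₀ ≤ q / (T * C₄ + 1) := by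
    have hTlo' : 0 < -Tlo / 2 := by linarith
    have h7 : 0 < q / (T * C₄ + 1) := by positivity
    refine ⟨min h₁ (min h₂ (min h₃ (min 1 (min (T / 2) (min (-Tlo / 2) (min η₁
      (q / (T * C₄ + 1)))))))), ?_, ?_⟩
    · simp only [gt_iff_lt, lt_min_iff]
      exact ⟨hh₁, hh₂, hh₃, one_pos, by linarith, hTlo', hη₁0, h7⟩
    · simpa only [le_min_iff] using le_refl (min h₁ (min h₂ (min h₃ (min 1 (min (T / 2)
        (min (-Tlo / 2) (min η₁ (q / (T * C₄ + 1)))))))))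
  -- The first bound starts `d` below `η`, the second keeps the contribution `κ Kn δ₀` below `q`.
  set ε := min (η / (Kn + 1)) (q / (κ * Kn + 1)) with hε
  have hε0 : 0 < ε := lt_min (by positivity) (by positivity)
  -- `C` dominates the exponential rate `C₄`, the coefficient `κ Kn` of the initial error of `Γ` and
  -- the coefficient `T C₄` of `h^s`.
  refine ⟨max C₄ (max (κ * Kn) (T * C₄)) + 1, by positivity, h₀, hh₀, by linarith, by linarith,
    Metric.ball uinit q, Metric.ball_mem_nhds _ hq0, ε, hε0, fun u₀ hu₀ h hh γinit hγ => ?_⟩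
  obtain ⟨hpos, hlt⟩ := hh
  obtain ⟨un, Γ, U, hun0, hΓ0, hΓ, hUn⟩ := exists_method_sequence rk L N D Θ h u₀ γinit
  refine ⟨un, Γ, U, hun0, hΓ0, ?_⟩
  set δ₀ := ⨆ i, ‖N (u (-h + rk.c i * h)) - γinit i‖ with hδ₀
  have hδ₀le : ∀ i, ‖N (u (-h + rk.c i * h)) - γinit i‖ ≤ δ₀ := fun i =>
    le_ciSup (f := fun i => ‖N (u (-h + rk.c i * h)) - γinit i‖) (Set.finite_range _).bddAbove i
  have hδ₀0 : 0 ≤ δ₀ := Real.iSup_nonneg fun _ => norm_nonneg _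
  have hδ₀ε : δ₀ ≤ ε := ciSup_le fun i => (hγ i).le
  set a : ℕ → ℝ := fun n => ‖u (n * h) - un n‖ with ha
  set dv : ℕ → Fin s → Ω.Sobolev σ := fun n i => N (u (n * h - h + rk.c i * h)) - Γ n i with hdv
  set e := h ^ s with he
  have he0 : 0 ≤ e := by positivity
  have he1 : e ≤ h := pow_le_of_le_one hpos.le (hlt.le.trans e₄) (by omega)
  -- times
  have htime : ∀ n : ℕ, n * h ≤ T → (n : ℝ) * h ∈ Icc (Tlo / 2) T := fun n hn =>
    ⟨by have : 0 ≤ (n : ℝ) * h := by positivity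
        linarith, hn⟩
  have hdvle : ∀ (n : ℕ) i, ‖N (u (n * h - h + rk.c i * h)) - Γ n i‖ ≤ nrm (dv n) := fun n i =>
    (norm_le_pi_norm (dv n) i).trans (hnrm _)
  -- bounds on the auxiliary variables
  have hΓbound : ∀ n : ℕ, n * h ≤ T → nrm (dv n) ≤ η → ∀ i, ‖Γ n i‖ ≤ M + m := by
    intro n hn hdn i
    have h1 : ‖N (u (n * h - h + rk.c i * h))‖ ≤ M + m / 2 := by
      have hch := mul_nonneg (hc01 i).1 hpos.le
      have hch' := mul_le_of_le_one_left hpos.le (hc01 i).2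
      -- For `n = 0` the times lie in `[-h, 0]`, where continuity of `N ∘ u` at `0` replaces the
      -- bound on `[0, T]`.
      rcases Nat.eq_zero_or_pos n with rfl | hn0
      · apply hNcont
        rw [abs_lt]
        constructor <;> simp only [Nat.cast_zero, zero_mul] <;> linarith
      · have h2 : h ≤ n * h := le_mul_of_one_le_left hpos.le (by exact_mod_cast hn0)
        exact (hMbound _ ⟨by linarith, by linarith⟩).trans (by linarith)
    have h2 := hdvle n i
    have h3 := norm_sub_norm_le (Γ n i) (N (u (n * h - h + rk.c i * h)))
    rw [norm_sub_rev] at h3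
    linarith
  have hunbound : ∀ n : ℕ, n * h ≤ T → a n ≤ η' → ‖un n‖ ≤ X + 1 := by
    intro n hn han
    have h1 := hX _ (htime n hn)
    have h2 := norm_sub_norm_le (un n) (u (n * h))
    rw [norm_sub_rev] at h2
    have h3 : a n ≤ 1 := han.trans (min_le_left _ _)
    simp only [ha] at h3
    linarith
  have hΓbound' : ∀ n : ℕ, n * h ≤ T → a n ≤ η' → nrm (dv n) ≤ η → ∀ i, ‖Γ (n + 1) i‖ ≤ M' := by
    intro n hn han hdn i
    have h1 := (pi_norm_le_iff_of_nonneg (by positivity)).2 (hΓbound n hn hdn)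
    rw [hΓ]
    refine (norm_add_le _ _).trans (add_le_add ?_ ?_)
    · refine le_trans (norm_le_pi_norm (matrixAction D (Γ n)) i) ?_
      exact (norm_matrixAction_le hDr0 hDr _).trans (mul_le_mul_of_nonneg_left h1 hDr0)
    · rw [norm_smul]
      exact mul_le_mul (norm_le_pi_norm Θ i) (hNB' _ (hunbound n hn han)) (norm_nonneg _)
        (norm_nonneg _)
  have hwell : ∀ n : ℕ, n * h ≤ T → a n ≤ η' → nrm (dv n) ≤ η →
      IsStageSolution rk L h (un n) (Γ (n + 1)) (U n) ∧
      (∀ U'', IsStageSolution rk L h (un n) (Γ (n + 1)) U'' → U'' = U n) ∧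
      IsUpdate rk L h (un n) (Γ (n + 1)) (U n) (un (n + 1)) := fun n hn han hdn =>
    hUn n (hstep h ⟨hpos, hlt.trans_le e₁⟩ (hS h hpos) (un n) (Γ (n + 1))
      (hΓbound' n hn han hdn))
  -- error recursion
  have hrec : ∀ n : ℕ, ((n + 1 : ℕ) : ℝ) * h ≤ T → a n ≤ η' → nrm (dv n) ≤ η →
      nrm (dv (n + 1)) ≤ ρ * nrm (dv n) + C₃ * (a n + e) ∧
        a (n + 1) ≤ (1 + C₂ * h) * a n + C₂ * (h * nrm (dv (n + 1)) + Kq * (h * e)) := by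
    intro n hn1 han hdn
    have hsucc : ((n + 1 : ℕ) : ℝ) * h = n * h + h := by push_cast; ring
    have hn : (n : ℝ) * h ≤ T := by linarith
    have ht := htime n hn
    have hth : (n : ℝ) * h + h ∈ Icc (Tlo / 2) T := hsucc ▸ htime (n + 1) hn1
    have hth' : (n : ℝ) * h - h ∈ Icc (Tlo / 2) T := by
      have : 0 ≤ (n : ℝ) * h := by positivity
      exact ⟨by linarith, by linarith⟩
    have hmem : ∀ i, (n : ℝ) * h + rk.c i * h ∈ Icc (Tlo / 2) T := fun i => by
      have hch := mul_nonneg (hc01 i).1 hpos.le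
      have hch' := mul_le_of_le_one_left hpos.le (hc01 i).2
      exact ⟨by linarith [ht.1], by linarith [hth.2]⟩
    have hlip : ‖N (u (n * h)) - N (un n)‖ ≤ Lc * a n := by
      have h1 := hLc.norm_sub_le (x := u (n * h)) (y := un n)
        (mem_closedBall_zero_iff.2 ((hX _ ht).trans (by linarith)))
        (mem_closedBall_zero_iff.2 (hunbound n hn han))
      exact h1
    constructor
    -- The new error of `Γ` is `D` applied to the old one plus `y`, which collects the Lipschitz
    -- error of `N` at `uₙ` and the extrapolation defect of the exact solution.
    · set y : Fin s → Ω.Sobolev σ := fun i => Θ i • (N (u (n * h)) - N (un n)) +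
        (N (u (n * h + rk.c i * h)) - (∑ j, D i j • N (u (n * h - h + rk.c j * h)) +
          Θ i • N (u (n * h)))) with hy
      have h1 : dv (n + 1) = matrixAction D (dv n) + y := by
        ext1 i
        simp only [hdv, hy, matrixAction, Pi.add_apply, hΓ, gammaStep, hsucc, smul_sub,
          Finset.sum_sub_distrib, add_sub_cancel_right]
        abel
      have h2 : ‖y‖ ≤ Θm * (Lc * a n) + Kc * e := by
        have := hnrm0 (dv n)
        have han0 : 0 ≤ a n := norm_nonneg _
        rw [pi_norm_le_iff_of_nonneg (by positivity)]
        intro i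
        refine (norm_add_le _ _).trans (add_le_add ?_ (hKc _ h hpos.le hth' hth i))
        rw [norm_smul]
        exact mul_le_mul (norm_le_pi_norm Θ i) hlip (norm_nonneg _) (norm_nonneg _)
      rw [h1]
      refine (hnrm_add _ _).trans (add_le_add (hnrm_D _) ((hnrm' y).trans ?_))
      have han0 : 0 ≤ a n := norm_nonneg _
      have h3 : 0 ≤ Θm * Lc * e + Kc * a n := by positivity
      calc Kn * ‖y‖ ≤ Kn * (Θm * (Lc * a n) + Kc * e) := by gcongr
        _ ≤ Kn * (Θm * (Lc * a n) + Kc * e + (Θm * Lc * e + Kc * a n)) :=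
            mul_le_mul_of_nonneg_left (le_add_of_nonneg_right h3) hKn0
        _ = C₃ * (a n + e) := by rw [hC₃]; ring
    · obtain ⟨hU1, -, hU3⟩ := hwell n hn han hdn
      obtain ⟨hq1, hq2⟩ := hKq _ h hpos.le ht hth
      choose g hg hg' using fun i => (hderiv _ (hmem i)).2
      -- The reference stages are the exact values `u(tₙ + cᵢh)`. The error of `Γₙ`, which is used
      -- in this step, is `dv (n + 1)` because of the index shift.
      have h1 := herr h ⟨hpos, hlt.trans_le e₂⟩ (hS h hpos) (un n) (un (n + 1)) (Γ (n + 1)) (U n)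
        (hΓbound' n hn han hdn) hU1 hU3 (u (n * h)) (u (n * h + h))
        (fun i => N (u (n * h + rk.c i * h))) (fun i => u (n * h + rk.c i * h))
        (fun i => deriv u (n * h + rk.c i * h)) g (nrm (dv (n + 1))) (Kq * h ^ (s + 1))
        hg hg' (fun i => hX _ (hmem i)) (fun i => by
          have := hdvle (n + 1) i
          rwa [hsucc, add_sub_cancel_right] at this) (hnrm0 _) hq1 hq2
      simp only [ha, hsucc]
      rw [pow_succ, mul_comm (h ^ s) h] at h1
      exact h1
  -- conclusion
  have hdv0 : nrm (dv 0) ≤ Kn * δ₀ := by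
    refine (hnrm' _).trans (mul_le_mul_of_nonneg_left ?_ hKn0)
    rw [pi_norm_le_iff_of_nonneg hδ₀0]
    intro i
    have := hδ₀le i
    simpa [hdv, hΓ0] using this
  have ha0 : a 0 = ‖uinit - u₀‖ := by simp [ha, hu0, hun0]
  have hx₀ : a 0 + κ * h * nrm (dv 0) ≤ ‖uinit - u₀‖ + κ * Kn * δ₀ := by
    rw [ha0]
    have h1 : κ * h * nrm (dv 0) ≤ κ * 1 * (Kn * δ₀) := by
      have := hnrm0 (dv 0)
      have := hlt.le.trans e₄
      gcongr
    linarith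
  have hd₀ : nrm (dv 0) ≤ η := by
    have h1 : δ₀ * (Kn + 1) ≤ η := (le_div_iff₀ (by positivity)).1 (hδ₀ε.trans (min_le_left _ _))
    linarith
  have hsmall : Real.exp (C₄ * T) * (‖uinit - u₀‖ + κ * Kn * δ₀ + T * C₄ * e) ≤ η' := by
    rw [← hq']
    have h1 : ‖uinit - u₀‖ ≤ q := by
      have := (Metric.mem_ball.1 hu₀).le
      rwa [dist_eq_norm, norm_sub_rev] at this
    have h2 : δ₀ * (κ * Kn + 1) ≤ q :=
      (le_div_iff₀ (by positivity)).1 (hδ₀ε.trans (min_le_right _ _))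
    have h3 : e * (T * C₄ + 1) ≤ q :=
      (le_div_iff₀ (by positivity)).1 ((he1.trans hlt.le).trans e₈)
    gcongr <;> linarith
  have hηs : ρ * η + C₃ * (η' + e) ≤ η := by
    have h1 : η' ≤ η₁ := min_le_right _ _
    have h2 : e ≤ η₁ := (he1.trans hlt.le).trans e₇
    have h3 : η₁ * (2 * (C₃ + 1)) = (1 - ρ) * η := by rw [hη₁]; field_simp
    have h4 : C₃ * (η' + e) ≤ C₃ * (η₁ + η₁) := by gcongr
    linarith
  have hfinal := discrete_gronwall_bootstrap (a := a) (d := fun n => nrm (dv n))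
    (fun n => norm_nonneg _) (fun n => hnrm0 _) hpos hρ0.le hκ0 hC₂0 hC₃0 hKq0 he0 hκ' hC₄ hx₀
    hd₀ hsmall hηs hrec
  intro n hn
  obtain ⟨-, h2, h3⟩ := hfinal n hn
  obtain ⟨hU1, hU2, hU3⟩ := hwell n hn h2 h3
  refine ⟨hΓ n, hU1, hU2, hU3, hΓbound n hn h3, fun k hk => ?_⟩
  have hkn : (k : ℝ) * h ≤ n * h := by gcongr
  -- The Gronwall bound is taken at `k` and enlarged to the exponent at `n`; the factor `kh` in
  -- front of `h^s` is replaced by `T`.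
  obtain ⟨h4, -, -⟩ := hfinal k (hkn.trans hn)
  refine h4.trans ?_
  set C := max C₄ (max (κ * Kn) (T * C₄)) + 1 with hC
  have c1 : C₄ ≤ C := (le_max_left _ _).trans (le_add_of_nonneg_right zero_le_one)
  have c2 : κ * Kn ≤ C := ((le_max_left _ _).trans (le_max_right _ _)).trans
    (le_add_of_nonneg_right zero_le_one)
  have c3 : T * C₄ ≤ C := ((le_max_right _ _).trans (le_max_right _ _)).trans
    (le_add_of_nonneg_right zero_le_one)
  have hk0 : 0 ≤ (k : ℝ) * h := by positivity
  have c4 : (k : ℝ) * h * C₄ ≤ T * C₄ := mul_le_mul_of_nonneg_right (hkn.trans hn) hC₄0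
  have hC0 : 0 ≤ C := hC₄0.trans c1
  rw [mul_assoc C, mul_add C, ← add_assoc]
  have c5 : (k : ℝ) * h * C₄ ≤ C := c4.trans c3
  gcongr
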